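/- Let $n,s,k$ be non-negative integers. A matrix $G\in\mathbb F_2^{s\times n}$ with linearly independent rows is a generator matrix of the binary linear code $C\subseteq\mathbb F_2^n$ spanned by its rows; write $G^h$ for its $h$-th column and $e_i$ for the $i$-th unit vector of $\mathbb F_2^s$. Call $G$ a $k$-PIR matrix if for every $i\in\{1,\dots,s\}$ there are $k$ mutually disjoint sets $R_1,\dots,R_k\subseteq\{1,\dots,n\}$ with $\sum_{h\in R_j}G^h=e_i$ for all $j$. Call $G$ systematic if every $e_i$ occurs among its columns (i.e. $G$ contains an $s\times s$ unit matrix), and projective if its columns are pairwise linearly independent. An $s$-dimensional $k$-PIR code of length $n$ is a code having a generator matrix $G\in\mathbb F_2^{s\times n}$ that is a $k$-PIR matrix; it is a systematic $k$-PIR code if $G$ can be chosen to be, in addition, systematic. Let $P(s,k)$ be the smallest length of an $s$-dimensional $k$-PIR code. **Proposition.** 1. $P(6,8)=19$. 2. The matrix $$ \begin{pmatrix} 0&1&0&1&1&1&1&0&1&1&1&1&0&1&1&1&0&1&1\\ 1&1&1&1&0&1&0&1&1&1&1&0&1&1&0&1&1&1&0\\ 1&1&1&1&0&0&1&1&1&1&0&1&1&1&1&1&0&0&1\\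 1&1&0&0&1&1&1&1&1&0&1&1&1&1&0&0&1&1&1\\ 1&1&0&0&0&0&0&0&0&1&1&1&1&1&1&1&1&1&1\\ 0&0&1&1&1&1&1&1&1&1&1&1&1&1&0&0&0&0&0 \end{pmatrix} $$ is the generator matrix of a $6$-dimensional binary linear code of length $19$; it is an $8$-PIR matrix, it is projective, and it is not systematic. 3. Every systematic $6$-dimensional $8$-PIR code of length $n$ satisfies $n\ge 20$. 4. Consequently it is not true that for all $s,k\ge 1$ there is a systematic $s$-dimensional $k$-PIR code of length $P(s,k)$. -/

import Mathlib

namespace PIR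

/-- `G` is a generator matrix of the binary linear code `C` of length `n`: its `s` rows form a
basis of `C` (so `C` is an `[n, s]` code). -/
def IsGeneratorMatrix {s n : ℕ} (G : Matrix (Fin s) (Fin n) (ZMod 2))
    (C : Submodule (ZMod 2) (Fin n → ZMod 2)) : Prop :=
  LinearIndependent (ZMod 2) G.row ∧ Submodule.span (ZMod 2) (Set.range G.row) = C

/-- `R` is a recovery set for the `i`-th unit vector: the columns of `G` indexed by `R` sum
to `e_i`. -/
def IsRecoverySet {s n : ℕ} (G : Matrix (Fin s) (Fin n) (ZMod 2)) (i : Fin s)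
    (R : Finset (Fin n)) : Prop :=
  ∑ h ∈ R, G.col h = Pi.single i 1

/-- Every unit vector has `k` mutually disjoint recovery sets. -/
def IsPIRMatrix {s n : ℕ} (k : ℕ) (G : Matrix (Fin s) (Fin n) (ZMod 2)) : Prop :=
  ∀ i : Fin s, ∃ R : Fin k → Finset (Fin n),
    (∀ j, IsRecoverySet G i (R j)) ∧ ∀ j j', j ≠ j' → Disjoint (R j) (R j')

/-- `G` contains an `s × s` unit matrix, formed by some `s` of its columns. -/
def IsSystematic {s n : ℕ} (G : Matrix (Fin s) (Fin n) (ZMod 2)) : Prop :=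
  ∃ f : Fin s → Fin n, G.submatrix id f = 1

/-- The columns of `G` are pairwise linearly independent. -/
def IsProjective {s n : ℕ} (G : Matrix (Fin s) (Fin n) (ZMod 2)) : Prop :=
  ∀ h h' : Fin n, h ≠ h' → LinearIndependent (ZMod 2) ![G.col h, G.col h']

/-- `C` is an `s`-dimensional `k`-PIR code of length `n`. -/
def IsPIRCode (s k : ℕ) {n : ℕ} (C : Submodule (ZMod 2) (Fin n → ZMod 2)) : Prop :=
  ∃ G : Matrix (Fin s) (Fin n) (ZMod 2), IsGeneratorMatrix G C ∧ IsPIRMatrix k G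

/-- `C` is a systematic `s`-dimensional `k`-PIR code of length `n`: one and the same generator
matrix is systematic and provides the recovery sets. -/
def IsSystematicPIRCode (s k : ℕ) {n : ℕ} (C : Submodule (ZMod 2) (Fin n → ZMod 2)) : Prop :=
  ∃ G : Matrix (Fin s) (Fin n) (ZMod 2),
    IsGeneratorMatrix G C ∧ IsPIRMatrix k G ∧ IsSystematic G

/-- `P(s, k)`: the smallest length of an `s`-dimensional `k`-PIR code. -/
noncomputable def P (s k : ℕ) : ℕ :=
  sInf {n : ℕ | ∃ C : Submodule (ZMod 2) (Fin n → ZMod 2), IsPIRCode s k C}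

/-- The explicit `6 × 19` matrix. -/
def G19 : Matrix (Fin 6) (Fin 19) (ZMod 2) :=
  !![0, 1, 0, 1, 1, 1, 1, 0, 1, 1, 1, 1, 0, 1, 1, 1, 0, 1, 1;
     1, 1, 1, 1, 0, 1, 0, 1, 1, 1, 1, 0, 1, 1, 0, 1, 1, 1, 0;
     1, 1, 1, 1, 0, 0, 1, 1, 1, 1, 0, 1, 1, 1, 1, 1, 0, 0, 1;
     1, 1, 0, 0, 1, 1, 1, 1, 1, 0, 1, 1, 1, 1, 0, 0, 1, 1, 1;
     1, 1, 0, 0, 0, 0, 0, 0, 0, 1, 1, 1, 1, 1, 1, 1, 1, 1, 1;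
     0, 0, 1, 1, 1, 1, 1, 1, 1, 1, 1, 1, 1, 1, 0, 0, 0, 0, 0]

end PIR

/-! Disjoint recovery sets force minimum distance 8: a functional that is nonzero on `e_i` is
nonzero on some column of each recovery set of `e_i`. Averaging over the functionals that kill a
j-dimensional subspace (Plotkin) leaves at least 16 - 16/2^(6-j) columns outside it. So dimensions
1, 2, 3, 4 hold at most 3, 4, 5, 7 columns when n = 19, and 2, 3, 4, 6 when n = 18.

Lower bound 19. If `a` recovery sets of v are singletons and `b` are pairs, then 24 ≤ n + 2a + b.
For n ≤ 18 and a > 0, two pairs and a singleton overfill dimension 3. For a = 0, six pairs and one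
further column give seven points of the five-dimensional quotient by v. Their relations form a space
of dimension at least 2 in which nonzero weights are at least 5, but two relations and their sum
have total weight at most 14. The explicit matrix attains 19.

No systematic code of length 19. A unit vector that is a column is a star (the column plus three
disjoint pairs summing to it) or a multiple column, and at most one vector is multiple, so five are
stars. Two of these, v and v', have a sum that is not a column. A star is the full set of columns in
a four-dimensional subspace. In a basis with v = 1 and v' = 16 the columns are the star
{1,2,3,4,5,8,9} and four balanced points, one of them 16c, in each coset c = 1, 2, 3. An exhaustive
check of these finitely many configurations (`searchFails_eq_true`) shows that distance 8 leaves at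
most four star candidates whenever 16 is one, a contradiction. -/

namespace PIR

/-! ### Minimum distance and the Plotkin bound on subspaces -/

open Finset Module

variable {s n k : ℕ}

/-- Every nonzero functional is nonzero on at least `d` of the vectors `c h`: the code with
columns `c h` has minimum distance at least `d`. -/
def HasDistance {V : Type*} [AddCommGroup V] [Module (ZMod 2) V] (d : ℕ) (c : Fin n → V) : Prop :=
  ∀ f : Dual (ZMod 2) V, f ≠ 0 → d ≤ #{h | f (c h) ≠ 0}

/-- Some `e_i` has nonzero image under `f`, so each of its `k` recovery sets contains a column on
which `f` is nonzero; disjointness makes these columns distinct. -/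
theorem IsPIRMatrix.hasDistance {G : Matrix (Fin s) (Fin n) (ZMod 2)} (hG : IsPIRMatrix k G) :
    HasDistance k G.col := by
  intro f hf
  obtain ⟨i, hi⟩ : ∃ i, f (Pi.single i 1) ≠ 0 := by
    by_contra! h
    refine hf (LinearMap.pi_ext' fun i => LinearMap.ext_ring ?_)
    simpa using h i
  obtain ⟨R, hR, hdisj⟩ := hG i
  have hex : ∀ j, ∃ h ∈ R j, f (G.col h) ≠ 0 := by
    intro j
    apply Finset.exists_ne_zero_of_sum_ne_zero
    rw [← map_sum, hR j]
    exact hi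
  choose g hgR hg using hex
  have hinj : Function.Injective g := by
    intro j j' hjj
    by_contra hne
    exact Finset.disjoint_left.1 (hdisj j j' hne) (hgR j) (hjj ▸ hgR j')
  calc k = #(univ.image g) := by rw [card_image_of_injective _ hinj]; simp
    _ ≤ _ := card_le_card fun x hx => by
      obtain ⟨j, -, rfl⟩ := mem_image.1 hx
      simpa using hg j

/-- A `k`-PIR matrix with `k ≥ 1` has linearly independent rows. -/
theorem IsPIRMatrix.linearIndependent_row {G : Matrix (Fin s) (Fin n) (ZMod 2)} (hk : 0 < k)
    (hG : IsPIRMatrix k G) : LinearIndependent (ZMod 2) G.row := by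
  rw [Fintype.linearIndependent_iff]
  intro g hg i
  obtain ⟨R, hR, -⟩ := hG i
  have h1 : ∀ h, ∑ i, g i * G i h = 0 := fun h => by simpa using congrFun hg h
  have h2 : ∀ i', ∑ h ∈ R ⟨0, hk⟩, G i' h = (Pi.single i 1 : Fin s → ZMod 2) i' := fun i' => by
    simpa using congrFun (hR ⟨0, hk⟩) i'
  calc g i = ∑ i', g i' * (Pi.single i 1 : Fin s → ZMod 2) i' := by simp [Pi.single_apply]
    _ = ∑ h ∈ R ⟨0, hk⟩, ∑ i', g i' * G i' h := by
      rw [Finset.sum_comm]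
      simp_rw [← h2, Finset.mul_sum]
    _ = 0 := by simp [h1]

section Subspace

variable {V : Type*} [AddCommGroup V] [Module (ZMod 2) V]

/-- Translation by one functional that is nonzero at `x` injects the functionals nonzero at `x` into
those vanishing there. -/
theorem two_mul_card_eval_ne_zero_le (A : Finset (Dual (ZMod 2) V))
    (hA : ∀ f ∈ A, ∀ g ∈ A, f + g ∈ A) (x : V) : 2 * #{f ∈ A | f x ≠ 0} ≤ #A := by
  classical
  rcases Finset.eq_empty_or_nonempty ({f ∈ A | f x ≠ 0}) with h | ⟨f₀, h₀⟩
  · simp [h]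
  have h₀' := mem_filter.1 h₀
  have key : ∀ a b : ZMod 2, a ≠ 0 → b ≠ 0 → a + b = 0 := by decide
  have : #{f ∈ A | f x ≠ 0} ≤ #{f ∈ A | ¬ f x ≠ 0} := by
    refine card_le_card_of_injOn (fun f => f₀ + f) ?_ (fun a _ b _ h => add_left_cancel h)
    intro f hf
    have hf' := mem_filter.1 hf
    simp only [coe_filter, Set.mem_ofPred_eq, not_not, LinearMap.add_apply]
    exact ⟨hA _ h₀'.1 _ hf'.1, key _ _ h₀'.2 hf'.2⟩
  have := card_filter_add_card_filter_not (s := A) (fun f => f x ≠ 0)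
  omega

/-- Plotkin bound for the columns outside of a subspace. -/
theorem HasDistance.subspace_bound [Finite V] {c : Fin n → V} (hc : HasDistance 8 c)
    (W : Submodule (ZMod 2) V) {T : Finset (Fin n)} (hT : ∀ h ∈ T, c h ∈ W) :
    16 * 2 ^ (finrank (ZMod 2) V - finrank (ZMod 2) W) ≤
      (n - #T) * 2 ^ (finrank (ZMod 2) V - finrank (ZMod 2) W) + 16 := by
  classical
  have : Fintype V := Fintype.ofFinite V
  have : Finite (Dual (ZMod 2) V) := Module.finite_of_finite (ZMod 2)
  have : Fintype (Dual (ZMod 2) V) := Fintype.ofFinite _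
  set A : Finset (Dual (ZMod 2) V) := {f | f ∈ W.dualAnnihilator} with hAdef
  have hAcard : #A = 2 ^ (finrank (ZMod 2) V - finrank (ZMod 2) W) := by
    have h1 : #A = Nat.card W.dualAnnihilator := by
      rw [Nat.card_eq_fintype_card, Fintype.card_subtype]
    have h2 := Subspace.finrank_add_finrank_dualAnnihilator_eq W
    rw [h1, Module.natCard_eq_pow_finrank (K := ZMod 2), Nat.card_zmod]
    congr 1
    omega
  rw [← hAcard]
  have hadd : ∀ f ∈ A, ∀ g ∈ A, f + g ∈ A := by
    intro f hf g hg
    simp only [hAdef, mem_filter, mem_univ, true_and] at *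
    exact add_mem hf hg
  have h0 : (0 : Dual (ZMod 2) V) ∈ A := by simp [hAdef]
  -- Double count the pairs (functional in `A`, column where it is nonzero): each nonzero functional
  -- gives at least 8, a column in `T` gives none, any other column at most half of `A`.
  have hlow : (#A - 1) * 8 ≤ ∑ f ∈ A, #{h | f (c h) ≠ 0} := by
    calc (#A - 1) * 8 = ∑ f ∈ A.erase 0, 8 := by simp [card_erase_of_mem h0]
      _ ≤ ∑ f ∈ A.erase 0, #{h | f (c h) ≠ 0} :=
        sum_le_sum fun f hf => hc f (ne_of_mem_erase hf)
      _ ≤ _ := sum_le_sum_of_subset (erase_subset _ _)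
  have hswap : ∑ f ∈ A, #{h | f (c h) ≠ 0} = ∑ h, #{f ∈ A | f (c h) ≠ 0} := by
    simp_rw [card_filter]
    exact sum_comm
  have hzero : ∀ h ∈ T, #{f ∈ A | f (c h) ≠ 0} = 0 := by
    intro h hh
    rw [card_eq_zero, filter_eq_empty_iff]
    intro f hf
    simp only [hAdef, mem_filter, mem_univ, true_and] at hf
    exact not_not.2 ((Submodule.mem_dualAnnihilator f).1 hf _ (hT h hh))
  have hup : 2 * ∑ h, #{f ∈ A | f (c h) ≠ 0} ≤ (n - #T) * #A := by
    rw [← sum_add_sum_compl T, sum_eq_zero hzero, zero_add, mul_sum]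
    calc ∑ h ∈ Tᶜ, 2 * #{f ∈ A | f (c h) ≠ 0} ≤ ∑ h ∈ Tᶜ, #A :=
          sum_le_sum fun h _ => two_mul_card_eval_ne_zero_le A hadd _
      _ = _ := by simp [card_compl]
  have hpos : 0 < #A := card_pos.2 ⟨0, h0⟩
  omega

/-- The columns of a six-dimensional code of minimum distance `8` that lie in the span of `j`
vectors. -/
theorem HasDistance.span_bound [Finite V] (hV : finrank (ZMod 2) V = 6) {c : Fin n → V}
    (hc : HasDistance 8 c) (B : Finset V) (j : ℕ) (hj : j ≤ 6) (hB : #B ≤ j) {T : Finset (Fin n)}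
    (hT : ∀ h ∈ T, c h ∈ Submodule.span (ZMod 2) (B : Set V)) :
    16 * 2 ^ (6 - j) ≤ (n - #T) * 2 ^ (6 - j) + 16 := by
  have h := hc.subspace_bound _ hT
  have hr : finrank (ZMod 2) (Submodule.span (ZMod 2) (B : Set V)) ≤ j :=
    (finrank_span_finset_le_card B).trans hB
  rw [hV] at h
  set r := finrank (ZMod 2) (Submodule.span (ZMod 2) (B : Set V))
  -- The span may have dimension below `j`; the bound is then only stronger, by comparison after
  -- scaling with `2 ^ d`.
  obtain ⟨d, hd⟩ : ∃ d, 6 - r = 6 - j + d := ⟨j - r, by omega⟩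
  rw [hd, pow_add] at h
  have hd1 : 1 ≤ 2 ^ d := Nat.one_le_two_pow
  by_contra! hlt
  have h3 := Nat.mul_le_mul_right (2 ^ d) (Nat.succ_le_of_lt hlt)
  nlinarith

end Subspace

end PIR

/-! ### The lower bound 19 for the length -/

namespace PIR

open Finset Module

/-- The number of disjoint recovery sets of `v` with one and with two elements. -/
theorem count_small_sets {n : ℕ} {V : Type*} [AddCommGroup V] {c : Fin n → V}
    {v : V} (hv : v ≠ 0) {R : Fin 8 → Finset (Fin n)}
    (hR : ∀ j, ∑ h ∈ R j, c h = v) (hdisj : ∀ j j', j ≠ j' → Disjoint (R j) (R j')) :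
    24 ≤ n + 2 * #{j | #(R j) = 1} + #{j | #(R j) = 2} := by
  have h1 : ∑ j, #(R j) ≤ n := by
    rw [← card_biUnion fun j _ j' _ h => hdisj j j' h]
    simpa using card_le_univ (univ.biUnion R)
  have hpos : ∀ j, 0 < #(R j) := by
    intro j
    rw [card_pos]
    by_contra h
    rw [not_nonempty_iff_eq_empty] at h
    have := hR j
    rw [h, sum_empty] at this
    exact hv this.symm
  -- Crediting 2 to each singleton and 1 to each pair raises every size to at least 3.
  have h2 : ∑ j : Fin 8, 3 ≤ ∑ j, (#(R j) + 2 * (if #(R j) = 1 then 1 else 0) +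
      (if #(R j) = 2 then 1 else 0)) := by
    refine sum_le_sum fun j _ => ?_
    have := hpos j
    split_ifs <;> omega
  rw [sum_add_distrib, sum_add_distrib, ← mul_sum, ← card_filter, ← card_filter] at h2
  simp only [sum_const, card_univ, Fintype.card_fin, smul_eq_mul] at h2
  omega

variable {n : ℕ} {V : Type*} [AddCommGroup V] [Module (ZMod 2) V]

theorem zmod_two_add_self (x : V) : x + x = 0 := by
  have : (2 : ZMod 2) • x = 0 := by
    rw [show (2 : ZMod 2) = 0 from rfl, zero_smul]
  rwa [two_smul] at this

theorem eq_add_of_add_eq' {x y v : V} (h : x + y = v) : y = x + v := by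
  rw [← h, ← add_assoc, zmod_two_add_self, zero_add]

/-- Recovery sets of sizes one and two lie in a small subspace. -/
theorem HasDistance.small_sets_bound [Finite V] (hV : finrank (ZMod 2) V = 6) {c : Fin n → V}
    (hc : HasDistance 8 c) {v : V} {R : Fin 8 → Finset (Fin n)}
    (hR : ∀ j, ∑ h ∈ R j, c h = v) (hdisj : ∀ j j', j ≠ j' → Disjoint (R j) (R j'))
    {J : Finset (Fin 8)} (hJ : ∀ j ∈ J, #(R j) = 2) (hJ5 : #J ≤ 5) :
    16 * 2 ^ (5 - #J) ≤ (n - (#{j | #(R j) = 1} + 2 * #J)) * 2 ^ (5 - #J) + 16 := by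
  classical
  -- The columns of a pair with sum `v` are `x` and `x + v`; for other sizes `x` is a dummy.
  have hex : ∀ j, ∃ x : V, #(R j) = 2 → ∀ h ∈ R j, c h = x ∨ c h = x + v := by
    intro j
    by_cases hj : #(R j) = 2
    · obtain ⟨p, p', hne, hp⟩ := card_eq_two.1 hj
      have hs := hR j
      rw [hp, sum_pair hne] at hs
      refine ⟨c p, fun _ h hh => ?_⟩
      rw [hp, mem_insert, mem_singleton] at hh
      rcases hh with rfl | rfl
      · exact Or.inl rfl
      · exact Or.inr (eq_add_of_add_eq' hs)
    · exact ⟨0, fun h => absurd h hj⟩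
  choose x hx using hex
  set J₁ : Finset (Fin 8) := {j | #(R j) = 1} with hJ₁
  have hd : Disjoint J₁ J := by
    rw [Finset.disjoint_left]
    intro j h1 h2
    have := hJ j h2
    have := (mem_filter.1 h1).2
    omega
  have hcard : #((J₁ ∪ J).biUnion R) = #J₁ + 2 * #J := by
    rw [card_biUnion fun j _ j' _ h => hdisj j j' h, sum_union hd,
      sum_congr rfl fun j hj => (mem_filter.1 hj).2, sum_congr rfl hJ]
    simp [mul_comm, hJ₁]
  have hB : #(insert v (J.image x)) ≤ 1 + #J :=
    (card_insert_le _ _).trans (by have := card_image_le (s := J) (f := x); omega)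
  have := hc.span_bound hV (insert v (J.image x)) (1 + #J) (by omega) hB
    (T := (J₁ ∪ J).biUnion R) (by
      intro h hh
      have hvB : v ∈ Submodule.span (ZMod 2) ((insert v (J.image x) : Finset V) : Set V) :=
        Submodule.subset_span (by simp)
      obtain ⟨j, hj, hhj⟩ := mem_biUnion.1 hh
      rcases mem_union.1 hj with hj | hj
      · obtain ⟨p, hp⟩ := card_eq_one.1 (mem_filter.1 hj).2
        have hs := hR j
        rw [hp, sum_singleton] at hs
        rw [hp, mem_singleton] at hhj
        rw [hhj, hs]
        exact hvB
      · have hxB : x j ∈ Submodule.span (ZMod 2) ((insert v (J.image x) : Finset V) : Set V) :=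
          Submodule.subset_span (by simpa using Or.inr ⟨j, hj, rfl⟩)
        rcases hx j (hJ j hj) h hhj with h1 | h1 <;> rw [h1]
        · exact hxB
        · exact add_mem hxB hvB)
  rwa [hcard, show 6 - (1 + #J) = 5 - #J by omega] at this

/-- A code of minimum distance `8` and length at most `18` has no six disjoint pairs of columns
with the same sum together with another column. -/
theorem HasDistance.le_length_of_pairs [Finite V] (hV : finrank (ZMod 2) V = 6) {c : Fin n → V}
    (hc : HasDistance 8 c) {v : V} (hv : v ≠ 0) {ι : Type*} [Fintype ι] [DecidableEq ι]
    (hι : Fintype.card ι = 7) (I : ι → Finset (Fin n)) (k₀ : ι)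
    (hdisj : ∀ i i', i ≠ i' → Disjoint (I i) (I i')) (h₀ : 1 ≤ #(I k₀))
    (hI : ∀ i, i ≠ k₀ → 2 ≤ #(I i)) (q : ι → V)
    (hq : ∀ i, ∀ h ∈ I i, c h = q i ∨ c h = q i + v) : 19 ≤ n := by
  classical
  by_contra! hn
  let N := Submodule.span (ZMod 2) ({v} : Set V)
  have hN : finrank (ZMod 2) (V ⧸ N) = 5 := by
    have h1 := Submodule.finrank_quotient_add_finrank N
    have h2 : finrank (ZMod 2) N = 1 := finrank_span_singleton hv
    omega
  let Φ : (ι → ZMod 2) →ₗ[ZMod 2] (V ⧸ N) := Fintype.linearCombination (ZMod 2) fun i => N.mkQ (q i)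
  have hΦ : ∀ a, Φ a = 0 → ∑ i, a i • q i ∈ N := by
    intro a ha
    rw [← Submodule.Quotient.mk_eq_zero, ← Submodule.mkQ_apply, map_sum]
    simpa [Φ, Fintype.linearCombination_apply] using ha
  have hone : ∀ a : ZMod 2, a ≠ 0 → a = 1 := by decide
  -- A relation supported on four indices makes one `q l` redundant modulo `v`, so `v` and the other
  -- three span all four. That puts at least 7 columns (`k₀` may contribute only one) into dimension
  -- 4, where n ≤ 18 allows 6.
  have hweight : ∀ a, Φ a = 0 → a ≠ 0 → 5 ≤ #{i | a i ≠ 0} := by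
    intro a ha ha0
    by_contra! hlt
    obtain ⟨T, hT, hTcard⟩ := exists_superset_card_eq (s := ({i | a i ≠ 0} : Finset ι)) (n := 4)
      (by omega) (by omega)
    obtain ⟨l, hl⟩ := Function.ne_iff.1 ha0
    have hlT : l ∈ T := hT (by simpa using hl)
    set B := insert v ((T.erase l).image q) with hBdef
    have hB : #B ≤ 4 := by
      have h1 := card_insert_le v ((T.erase l).image q)
      have h2 := card_image_le (s := T.erase l) (f := q)
      rw [card_erase_of_mem hlT] at h2
      rw [hBdef]
      omega
    have hvB : v ∈ Submodule.span (ZMod 2) (B : Set V) := Submodule.subset_span (by simp [hBdef])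
    have hqB' : ∀ i ∈ T.erase l, q i ∈ Submodule.span (ZMod 2) (B : Set V) := fun i hi =>
      Submodule.subset_span (by
        rw [hBdef, mem_coe]
        exact mem_insert_of_mem (mem_image_of_mem q hi))
    have hqB : ∀ i ∈ T, q i ∈ Submodule.span (ZMod 2) (B : Set V) := by
      intro i hi
      by_cases hil : i = l
      · subst hil
        have h1 : ∑ i, a i • q i ∈ Submodule.span (ZMod 2) (B : Set V) :=
          (Submodule.span_le.2 (by simpa using hvB) : N ≤ _) (hΦ a ha)
        have h2 : ∑ i, a i • q i = ∑ i ∈ T, a i • q i :=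
          (sum_subset (subset_univ T) fun j _ hj => by
            have : a j = 0 := by
              by_contra h
              exact hj (hT (by simpa using h))
            rw [this, zero_smul]).symm
        rw [h2, ← add_sum_erase _ _ hlT, hone _ hl, one_smul] at h1
        exact (Submodule.add_mem_iff_left _ (sum_mem fun j hj =>
          Submodule.smul_mem _ _ (hqB' j hj))).1 h1
      · exact hqB' i (mem_erase.2 ⟨hil, hi⟩)
    have hsize : 7 ≤ #(T.biUnion I) := by
      rw [card_biUnion fun i _ i' _ h => hdisj i i' h]
      have h1 : ∑ i ∈ T, 2 ≤ ∑ i ∈ T, (#(I i) + if i = k₀ then 1 else 0) := by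
        refine sum_le_sum fun i _ => ?_
        split_ifs with h
        · subst h; omega
        · exact hI i h
      rw [sum_add_distrib, sum_const, hTcard, sum_ite_eq'] at h1
      split_ifs at h1 <;> simp only [smul_eq_mul] at h1 <;> omega
    have := hc.span_bound hV B 4 (by norm_num) hB (T := T.biUnion I) (by
      intro h hh
      obtain ⟨i, hi, hhi⟩ := mem_biUnion.1 hh
      rcases hq i h hhi with h1 | h1 <;> rw [h1]
      · exact hqB i hi
      · exact add_mem (hqB i hi) hvB)
    omega
  -- Seven unknowns against five equations, plus the condition `a j = 0`.
  have hker : ∀ j, ∃ a, Φ a = 0 ∧ a j = 0 ∧ a ≠ 0 := by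
    intro j
    have hlt : finrank (ZMod 2) ((V ⧸ N) × ZMod 2) < finrank (ZMod 2) (ι → ZMod 2) := by
      rw [finrank_prod, hN, finrank_self, finrank_fintype_fun_eq_card, hι]
      norm_num
    have h1 := LinearMap.ker_ne_bot_of_finrank_lt (f := Φ.prod (LinearMap.proj j)) hlt
    obtain ⟨a, ha, ha0⟩ := (Submodule.ne_bot_iff _).1 h1
    have ha : Φ a = 0 ∧ a j = 0 := by simpa using ha
    exact ⟨a, ha.1, ha.2, ha0⟩
  obtain ⟨a, ha, -, ha0⟩ := hker k₀
  obtain ⟨j, hj⟩ := Function.ne_iff.1 ha0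
  obtain ⟨b, hb, hbj, hb0⟩ := hker j
  have hab0 : a + b ≠ 0 := fun h => hj (by simpa [hbj] using congrFun h j)
  have h1 := hweight a ha ha0
  have h2 := hweight b hb hb0
  have h3 := hweight (a + b) (by rw [map_add, ha, hb, add_zero]) hab0
  -- In each coordinate at most two of `a`, `b`, `a + b` are nonzero, so the weights total at most
  -- 14, whereas they should reach 15.
  have hsum : #{i | a i ≠ 0} + #{i | b i ≠ 0} + #{i | (a + b) i ≠ 0} ≤ ∑ i : ι, 2 := by
    rw [card_filter, card_filter, card_filter, ← sum_add_distrib, ← sum_add_distrib]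
    refine sum_le_sum fun i _ => ?_
    have : ∀ x y : ZMod 2, (if x ≠ 0 then 1 else 0) + (if y ≠ 0 then 1 else 0) +
        (if x + y ≠ 0 then 1 else 0) ≤ 2 := by decide
    exact this (a i) (b i)
  rw [sum_const, card_univ, hι, smul_eq_mul] at hsum
  omega

/-- A code of minimum distance `8` in which a nonzero vector has eight disjoint recovery sets has
length at least `19`. -/
theorem HasDistance.le_length [Finite V] (hV : finrank (ZMod 2) V = 6) {c : Fin n → V}
    (hc : HasDistance 8 c) {v : V} (hv : v ≠ 0) {R : Fin 8 → Finset (Fin n)}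
    (hR : ∀ j, ∑ h ∈ R j, c h = v) (hdisj : ∀ j j', j ≠ j' → Disjoint (R j) (R j')) :
    19 ≤ n := by
  classical
  by_contra! hn
  have hcount := count_small_sets hv hR hdisj
  -- With no pairs, the line through `v` alone: at most two singletons when n ≤ 18.
  have h0 := hc.small_sets_bound hV hR hdisj (J := ∅) (by simp) (by simp)
  simp only [card_empty, mul_zero, add_zero, Nat.sub_zero] at h0
  by_cases ha : #{j | #(R j) = 1} = 0
  -- No singletons: at least six pairs. One element `z j₀` of a further recovery set serves as the
  -- seventh point.
  · obtain ⟨J, hJ, hJ6⟩ := exists_subset_card_eq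
      (s := ({j | #(R j) = 2} : Finset (Fin 8))) (n := 6) (by omega)
    have hJ2 : ∀ j ∈ J, #(R j) = 2 := fun j hj => (mem_filter.1 (hJ hj)).2
    obtain ⟨j₀, hj₀⟩ : ∃ j₀, j₀ ∉ J := by
      by_contra! h
      have := (eq_univ_iff_forall.2 h) ▸ hJ6
      simp at this
    have hne : ∀ j, ∃ h, h ∈ R j := by
      intro j
      by_contra! h
      have := hR j
      rw [eq_empty_of_forall_notMem h, sum_empty] at this
      exact hv this.symm
    choose z hz using hne
    refine absurd (hc.le_length_of_pairs hV hv (ι := (insert j₀ J : Finset (Fin 8)))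
      (by rw [Fintype.card_coe, card_insert_of_notMem hj₀, hJ6])
      (fun i => if i.1 = j₀ then {z j₀} else R i) ⟨j₀, mem_insert_self _ _⟩ ?_ ?_ ?_
      (fun i => c (z i)) ?_) (by omega)
    · intro i i' hii'
      have hsub : ∀ j : Fin 8, (if j = j₀ then {z j₀} else R j) ⊆ R j := by
        intro j
        split_ifs with h
        · subst h; simpa using hz j
        · exact subset_rfl
      exact disjoint_of_subset_left (hsub i) (disjoint_of_subset_right (hsub i')
        (hdisj _ _ fun h => hii' (Subtype.ext h)))
    · simp
    · intro i hi
      have hi' : i.1 ≠ j₀ := fun h => hi (Subtype.ext h)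
      rw [if_neg hi', hJ2 _ ((mem_insert.1 i.2).resolve_left hi')]
    · intro i h hh
      split_ifs at hh with hi
      · rw [mem_singleton] at hh
        rw [hh, hi]
        exact Or.inl rfl
      · have hi2 := hJ2 _ ((mem_insert.1 i.2).resolve_left hi)
        by_cases hhz : h = z i
        · exact Or.inl (by rw [hhz])
        · right
          have heq : R i = {z i, h} := (eq_of_subset_of_card_le
            (by rw [insert_subset_iff, singleton_subset_iff]; exact ⟨hz _, hh⟩)
            (by rw [hi2, card_pair (Ne.symm hhz)])).symm
          have hs := hR i
          rw [heq, sum_pair (Ne.symm hhz)] at hs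
          exact eq_add_of_add_eq' hs
  -- One or two singletons leave at least two pairs, hence at least five columns in dimension 3,
  -- where n ≤ 18 allows four.
  · obtain ⟨J, hJ, hJ2⟩ := exists_subset_card_eq
      (s := ({j | #(R j) = 2} : Finset (Fin 8))) (n := 2) (by omega)
    have h2 := hc.small_sets_bound hV hR hdisj (J := J) (fun j hj => (mem_filter.1 (hJ hj)).2)
      (by omega)
    rw [hJ2] at h2
    omega

end PIR

/-! ### The exhaustive search, in a form the kernel evaluates -/

namespace PIR

/-- The inner product of the binary expansions of `u, x < 64`. -/
def dotBit (u x : ℕ) : Bool :=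
  (u.testBit 0 && x.testBit 0) ^^ (u.testBit 1 && x.testBit 1) ^^ (u.testBit 2 && x.testBit 2) ^^
  (u.testBit 3 && x.testBit 3) ^^ (u.testBit 4 && x.testBit 4) ^^ (u.testBit 5 && x.testBit 5)

/-- The number with base `256` digits `f u`, `u ∈ us`. -/
def pack (f : ℕ → ℕ) : List ℕ → ℕ
  | [] => 0
  | u :: us => f u + 256 * pack f us

/-- The nonzero functionals. -/
def functionals : List ℕ := List.range' 1 63

/-- The values of all functionals at `x`, one per base `256` digit. -/
def packedPoint (x : ℕ) : ℕ := pack (fun u => (dotBit u x).toNat) functionals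

/-- The sum of the packed values of a list of points: the digits are the codeword weights. -/
def packedWeights : List ℕ → ℕ
  | [] => 0
  | x :: l => packedPoint x + packedWeights l

/-- Evaluate `n` to a numeral before handing it to `k`. -/
def force (n : ℕ) (k : ℕ → Bool) : Bool :=
  match n with
  | 0 => k 0
  | m + 1 => k (Nat.succ m)

/-- Pair each entry of a list with its evaluated packed weights. -/
def withWeights : List (List ℕ) → (List (List ℕ × ℕ) → Bool) → Bool
  | [], k => k []
  | a :: l, k => force (packedWeights a) fun w => withWeights l fun r => k ((a, w) :: r)

/-- Structural version of `List.all`, convenient for evaluation by the kernel. -/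
noncomputable def forallList {α : Type} (p : α → Bool) (l : List α) : Bool :=
  List.rec true (fun a _ r => Bool.rec false r (p a)) l

/-- The points in the `c`-th coset of the span of `1, 2, 4, 8`. -/
def cosetPoints (c : ℕ) : List ℕ := List.range' (16 * c) 16

/-- Exactly two of the points have bit `i` set. -/
def balanced (i : ℕ) (l : List ℕ) : Bool := l.countP (fun x => x.testBit i) == 2

/-- The sorted balanced quadruples in a coset that start with its first point. -/
def quadruples (c : ℕ) : List (List ℕ) :=
  (cosetPoints c).flatMap fun y =>
    ((cosetPoints c).filter (Nat.ble y)).flatMap fun z =>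
      (((cosetPoints c).filter (Nat.ble z)).map fun t => [16 * c, y, z, t]).filter fun l =>
        balanced 1 l && balanced 2 l && balanced 3 l

/-- The seven points in the span of `1, 2, 4, 8`. -/
def starPoints : List ℕ := [1, 2, 3, 4, 5, 8, 9]

/-- The bit mask of a list of points. -/
def mask : List ℕ → ℕ
  | [] => 0
  | x :: l => 2 ^ x ||| mask l

/-- At least six points `y` of `l` have `x + y` in the set with bit mask `m`. -/
def isGood (m : ℕ) (l : List ℕ) (x : ℕ) : Bool :=
  Nat.ble 6 (l.countP fun y => m.testBit (x ^^^ y))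

/-- If `16` is a good point of `l`, there are at most four good points. -/
def fewGood (l : List ℕ) : Bool :=
  force (mask l) fun m => !isGood m l 16 || Nat.ble (l.countP (isGood m l)) 4

/-- For every choice of four points in each of the three cosets other than the span of
`1, 2, 4, 8` itself, either some codeword has weight less than `8` or there are few good points. -/
noncomputable def searchFails : Bool :=
  force (pack (fun _ => 128) functionals) fun high =>
  -- With offset 120 a digit has its top bit (128) set exactly when the weight is at least 8; the
  -- weights of 19 points cause no carry.
  force (packedWeights starPoints + pack (fun _ => 120) functionals) fun w₀ =>
  withWeights (quadruples 1) fun qa =>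
  withWeights (quadruples 2) fun qb =>
  withWeights (quadruples 3) fun qc =>
  forallList (fun a => force (Nat.add w₀ a.2) fun w₁ =>
  forallList (fun b => force (Nat.add w₁ b.2) fun w₂ =>
  forallList (fun c => cond (Nat.beq (Nat.land (Nat.add w₂ c.2) high) high)
    (fewGood (starPoints ++ a.1 ++ b.1 ++ c.1)) true) qc) qb) qa

set_option maxRecDepth 100000 in
theorem searchFails_eq_true : searchFails = true := by decide +kernel

end PIR

/-! ### Correctness of the search -/

namespace PIR

theorem force_eq (n : ℕ) (k : ℕ → Bool) : force n k = k n := by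
  cases n <;> rfl

theorem withWeights_eq (l : List (List ℕ)) (k : List (List ℕ × ℕ) → Bool) :
    withWeights l k = k (l.map fun a => (a, packedWeights a)) := by
  induction l generalizing k with
  | nil => rfl
  | cons a l ih => simp [withWeights, force_eq, ih]

theorem forallList_eq_true {α : Type} (p : α → Bool) (l : List α) :
    forallList p l = true ↔ ∀ a ∈ l, p a = true := by
  induction l with
  | nil => simp [forallList]
  | cons a l ih =>
    have : forallList p (a :: l) = (Bool.rec false (forallList p l) (p a) : Bool) := rfl
    rw [this]
    cases h : p a <;> simp [h, ih]

theorem pack_add (f g : ℕ → ℕ) (us : List ℕ) :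
    pack f us + pack g us = pack (fun u => f u + g u) us := by
  induction us with
  | nil => rfl
  | cons u us ih => simp only [pack, ← ih]; ring

theorem packedWeights_eq (l : List ℕ) :
    packedWeights l = pack (fun u => l.countP (dotBit u)) functionals := by
  induction l with
  | nil =>
    have : ∀ us, pack (fun _ => 0) us = 0 := fun us => by
      induction us with
      | nil => rfl
      | cons u us ih => simp [pack, ih]
    simp [packedWeights, this]
  | cons x l ih =>
    rw [packedWeights, ih, packedPoint, pack_add]
    congr 1
    funext u
    cases h : dotBit u x <;> simp [h, add_comm]

theorem packedWeights_append (l l' : List ℕ) :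
    packedWeights (l ++ l') = packedWeights l + packedWeights l' := by
  induction l with
  | nil => simp [packedWeights]
  | cons x l ih => simp [packedWeights, ih, add_assoc]

theorem pack_land_high (f : ℕ → ℕ) (us : List ℕ) (hf : ∀ u ∈ us, 128 ≤ f u ∧ f u < 256) :
    pack f us &&& pack (fun _ => 128) us = pack (fun _ => 128) us := by
  induction us with
  | nil => simp [pack]
  | cons u us ih =>
    have ih := ih fun v hv => hf v (List.mem_cons_of_mem _ hv)
    obtain ⟨h1, h2⟩ := hf u List.mem_cons_self
    have hd : ∀ d < 256, 128 ≤ d → d &&& 128 = 128 := by decide +kernel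
    -- Bitwise conjunction acts separately on the base 256 digits.
    have key : ∀ a b x y : ℕ, a < 256 → b < 256 →
        (a + 256 * x) &&& (b + 256 * y) = (a &&& b) + 256 * (x &&& y) := by
      intro a b x y ha hb
      have hab : a &&& b < 2 ^ 8 := lt_of_le_of_lt Nat.and_le_left ha
      apply Nat.eq_of_testBit_eq
      intro i
      rw [Nat.testBit_and, add_comm a, add_comm b, add_comm (a &&& b)]
      change ((2 ^ 8 * x + a).testBit i && (2 ^ 8 * y + b).testBit i) =
        (2 ^ 8 * (x &&& y) + (a &&& b)).testBit i
      rw [Nat.testBit_two_pow_mul_add _ (by simpa using ha),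
        Nat.testBit_two_pow_mul_add _ (by simpa using hb), Nat.testBit_two_pow_mul_add _ hab]
      split_ifs <;> simp [Nat.testBit_and]
    simp only [pack]
    rw [key _ _ _ _ h2 (by norm_num), ih, hd _ h2 h1]

theorem testBit_mask (l : List ℕ) (i : ℕ) : (mask l).testBit i = true ↔ i ∈ l := by
  induction l with
  | nil => simp [mask]
  | cons x l ih =>
    simp only [mask, Nat.testBit_or, Bool.or_eq_true, ih, List.mem_cons, Nat.testBit_two_pow,
      decide_eq_true_eq, @eq_comm _ x i]

/-- Only one direction of the packed test is needed: weights between 8 and 19 give digits between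
128 and 139, so the test passes and the search result applies. -/
theorem fewGood_of_quadruples {a b c : List ℕ} (ha : a ∈ quadruples 1) (hb : b ∈ quadruples 2)
    (hc : c ∈ quadruples 3)
    (hw : ∀ u ∈ functionals, 8 ≤ (starPoints ++ a ++ b ++ c).countP (dotBit u))
    (hlen : (starPoints ++ a ++ b ++ c).length ≤ 19) :
    fewGood (starPoints ++ a ++ b ++ c) = true := by
  have h := searchFails_eq_true
  simp only [searchFails, force_eq, withWeights_eq, forallList_eq_true, List.mem_map,
    forall_exists_index, and_imp, forall_apply_eq_imp_iff₂] at h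
  have h := h a ha b hb c hc
  have htest : Nat.land (Nat.add (Nat.add (Nat.add (packedWeights starPoints +
      pack (fun _ => 120) functionals) (packedWeights a)) (packedWeights b)) (packedWeights c))
      (pack (fun _ => 128) functionals) = pack (fun _ => 128) functionals := by
    have e : Nat.add (Nat.add (Nat.add (packedWeights starPoints +
        pack (fun _ => 120) functionals) (packedWeights a)) (packedWeights b)) (packedWeights c) =
        packedWeights (starPoints ++ a ++ b ++ c) + pack (fun _ => 120) functionals := by
      simp only [packedWeights_append, Nat.add_eq]
      ring
    rw [e, packedWeights_eq, pack_add]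
    refine pack_land_high _ _ fun u hu => ?_
    have h1 := hw u hu
    have h2 := (List.countP_le_length (p := dotBit u) (l := starPoints ++ a ++ b ++ c))
    omega
  rw [htest] at h
  simpa using h

end PIR

/-! ### Reduction of a length 19 code to the search -/

namespace PIR

theorem dotBit_xor_left (u u' x : ℕ) : dotBit (u ^^^ u') x = (dotBit u x ^^ dotBit u' x) := by
  have h : ∀ a b c d : Bool, ((a ^^ b) ^^ (c ^^ d)) = ((a ^^ c) ^^ (b ^^ d)) := by decide
  simp only [dotBit, Nat.testBit_xor, Bool.and_xor_distrib_right]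
  conv_rhs => rw [h]; arg 1; rw [h]; arg 1; rw [h]; arg 1; rw [h]; arg 1; rw [h]

/-- Two independent functionals vanish together on at most seven of `19` points. -/
theorem countP_two_functionals {L : Multiset ℕ} (hcard : L.card = 19)
    (hw : ∀ u, 0 < u → u < 64 → 8 ≤ L.countP (fun x => dotBit u x = true))
    {u u' : ℕ} (hu : 0 < u) (hu64 : u < 64) (hu' : 0 < u') (hu'64 : u' < 64) (hne : u ≠ u') :
    L.countP (fun x => dotBit u x = false ∧ dotBit u' x = false) ≤ 7 := by
  have hx : 0 < u ^^^ u' := Nat.pos_of_ne_zero fun h => hne (Nat.xor_eq_zero_iff.1 h)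
  have hx64 : u ^^^ u' < 64 := Nat.xor_lt_two_pow (n := 6) hu64 hu'64
  -- A point not killed by both functionals is nonzero under exactly two of `u`, `u'`, `u ^^^ u'`.
  -- Hence 3 · 8 + 2m ≤ 2 · 19.
  have key : ∀ M : Multiset ℕ, M.countP (fun x => dotBit u x = true) +
      M.countP (fun x => dotBit u' x = true) + M.countP (fun x => dotBit (u ^^^ u') x = true) +
      2 * M.countP (fun x => dotBit u x = false ∧ dotBit u' x = false) = 2 * M.card := by
    intro M
    induction M using Multiset.induction with
    | empty => simp
    | cons a M ih =>
      have hx := dotBit_xor_left u u' a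
      simp only [Multiset.countP_cons, Multiset.card_cons]
      cases h : dotBit u a <;> cases h' : dotBit u' a <;> simp only [h, h'] at hx <;>
        simp [hx] <;> omega
  have := key L
  have := hw _ hu hu64
  have := hw _ hu' hu'64
  have := hw _ hx hx64
  omega

/-- The columns in the span of `1, 2, 4, 8` are those of the star. -/
theorem filter_div_eq_starPoints {L : Multiset ℕ} (hcard : L.card = 19) (hlt : ∀ x ∈ L, x < 64)
    (hw : ∀ u, 0 < u → u < 64 → 8 ≤ L.countP (fun x => dotBit u x = true))
    (hmem : ∀ x ∈ starPoints, x ∈ L) :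
    (starPoints : Multiset ℕ) = L.filter (fun x => x / 16 = 0) := by
  refine Multiset.eq_of_le_of_card_le ?_ ?_
  · rw [Multiset.le_iff_subset (by decide)]
    intro x hx
    rw [Multiset.mem_filter]
    have : ∀ x ∈ starPoints, x / 16 = 0 := by decide
    exact ⟨hmem x hx, this x hx⟩
  · have h := countP_two_functionals hcard hw (u := 16) (u' := 32) (by norm_num) (by norm_num)
      (by norm_num) (by norm_num) (by norm_num)
    rw [← Multiset.countP_eq_card_filter]
    refine le_trans (le_of_eq (Multiset.countP_congr rfl fun x hx => ?_)) h
    have : ∀ x < 64, x / 16 = 0 ↔ dotBit 16 x = false ∧ dotBit 32 x = false := by decide +kernel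
    simpa using this x (hlt x hx)

/-- If both pairs lay below 32, each would have a member below 16, a star point other than 1 because
17 is not a column. Then 16 and two translated star points join the star to put eight columns into
some four-dimensional subspace. -/
theorem exists_ge_of_pairs {L : Multiset ℕ} (hcard : L.card = 19) (hlt : ∀ x ∈ L, x < 64)
    (hw : ∀ u, 0 < u → u < 64 → 8 ≤ L.countP (fun x => dotBit u x = true))
    (hmem : ∀ x ∈ starPoints, x ∈ L) (h16 : 16 ∈ L) (h17 : 17 ∉ L) {y y' : ℕ}
    (hy : y ∈ L) (hy16 : 16 ^^^ y ∈ L) (hy' : y' ∈ L) (hy'16 : 16 ^^^ y' ∈ L) (hne : y ≠ y')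
    (hne' : y ≠ 16 ^^^ y') : 32 ≤ y ∨ 32 ≤ y' := by
  by_contra! hlt32
  have hstar := filter_div_eq_starPoints hcard hlt hw hmem
  have hz : ∀ y ∈ L, 16 ^^^ y ∈ L → y < 32 →
      ∃ z ∈ [2, 3, 4, 5, 8, 9], 16 ^^^ z ∈ L ∧ (z = y ∨ z = 16 ^^^ y) := by
    have hsmall : ∀ z ∈ L, 16 ^^^ z ∈ L → z < 16 → z ∈ [2, 3, 4, 5, 8, 9] := by
      intro z hz hz16 hlt
      have h1 : z ∈ L.filter (fun x => x / 16 = 0) := by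
        rw [Multiset.mem_filter]; exact ⟨hz, by omega⟩
      rw [← hstar, Multiset.mem_coe] at h1
      have h2 : z ≠ 1 := by
        rintro rfl
        exact h17 hz16
      revert h1 h2
      simp only [starPoints, List.mem_cons]
      tauto
    intro y hy hy16 hlt
    have hxx : 16 ^^^ (16 ^^^ y) = y := by
      rw [← Nat.xor_assoc, Nat.xor_self, Nat.zero_xor]
    have h2 : ∀ y < 32, y < 16 ∨ 16 ^^^ y < 16 := by decide
    rcases h2 y hlt with h | h
    · exact ⟨y, hsmall y hy hy16 h, hy16, Or.inl rfl⟩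
    · exact ⟨16 ^^^ y, hsmall _ hy16 (by rwa [hxx]) h, by rwa [hxx], Or.inr rfl⟩
  obtain ⟨z, hzm, hzL, hzy⟩ := hz y hy hy16 hlt32.1
  obtain ⟨z', hzm', hzL', hzy'⟩ := hz y' hy' hy'16 hlt32.2
  have hzz : z ≠ z' := by
    rintro rfl
    rcases hzy with rfl | rfl <;> rcases hzy' with h | h
    · exact hne h
    · exact hne' h
    · exact hne' (by rw [← h, ← Nat.xor_assoc, Nat.xor_self, Nat.zero_xor])
    · exact hne (Nat.xor_right_injective h)
  -- Take `i` to be one of the bits 2, 4, 8 occurring in neither `z` nor `z'`: five star points and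
  -- all three new points avoid it.
  have hfin : ∀ z ∈ [2, 3, 4, 5, 8, 9], ∀ z' ∈ [2, 3, 4, 5, 8, 9], z ≠ z' → ∃ i ∈ [2, 4, 8],
      (starPoints ++ [16, 16 ^^^ z, 16 ^^^ z']).Nodup ∧
      8 ≤ (starPoints ++ [16, 16 ^^^ z, 16 ^^^ z']).countP
        (fun x => dotBit 32 x = false ∧ dotBit i x = false) := by
    decide +kernel
  obtain ⟨i, hi, hnodup, hcount⟩ := hfin z hzm z' hzm' hzz
  have hi' : 0 < i ∧ i < 64 ∧ 32 ≠ i := by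
    have : ∀ i ∈ [2, 4, 8], 0 < i ∧ i < 64 ∧ 32 ≠ i := by decide
    exact this i hi
  have hle : ((starPoints ++ [16, 16 ^^^ z, 16 ^^^ z'] : List ℕ) : Multiset ℕ) ≤ L := by
    rw [Multiset.le_iff_subset (by simpa using hnodup)]
    intro x hx
    rw [Multiset.mem_coe, List.mem_append] at hx
    rcases hx with hx | hx
    · exact hmem x hx
    · simp only [List.mem_cons, List.not_mem_nil, or_false] at hx
      rcases hx with rfl | rfl | rfl <;> assumption
  have h1 := Multiset.countP_le_of_le (fun x => dotBit 32 x = false ∧ dotBit i x = false) hle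
  have h2 := countP_two_functionals hcard hw (u := 32) (u' := i) (by norm_num) (by norm_num)
    hi'.1 hi'.2.1 hi'.2.2
  rw [Multiset.coe_countP] at h1
  omega

/-- The sorted list of `A` is the one enumerated; it starts with `16 * c`, the least point of the
coset. -/
theorem mem_quadruples {c : ℕ} {A : Multiset ℕ} (hcard : A.card = 4)
    (hA : ∀ x ∈ A, x / 16 = c) (hmem : 16 * c ∈ A)
    (hbal : ∀ i ∈ [1, 2, 3], A.countP (fun x => x.testBit i = true) = 2) :
    ∃ l ∈ quadruples c, (l : Multiset ℕ) = A := by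
  obtain ⟨l, hl⟩ : ∃ l, l = A.sort (· ≤ ·) := ⟨_, rfl⟩
  have hlA : (l : Multiset ℕ) = A := by rw [hl, Multiset.sort_eq]
  have hsort : l.Pairwise (· ≤ ·) := hl ▸ Multiset.pairwise_sort A (· ≤ ·)
  subst hlA
  refine ⟨l, ?_, rfl⟩
  simp only [Multiset.coe_card] at hcard
  match l, hcard with
  | [x, y, z, t], _ =>
    simp only [List.pairwise_cons, List.mem_cons, Multiset.mem_coe, Multiset.coe_countP,
      List.not_mem_nil, or_false, forall_eq_or_imp, forall_eq, IsEmpty.forall_iff,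
      implies_true, List.Pairwise.nil, and_true] at hsort hA hmem hbal
    obtain ⟨⟨hxy, hxz, hxt⟩, ⟨hyz, hyt⟩, hzt⟩ := hsort
    obtain ⟨hx, hy, hz, ht⟩ := hA
    obtain rfl : x = 16 * c := by omega
    simp only [quadruples, cosetPoints, List.mem_flatMap, List.mem_filter, List.mem_map,
      List.mem_range'_1, Nat.ble_eq, balanced, Bool.and_eq_true, beq_iff_eq]
    refine ⟨y, by omega, z, by omega, ⟨t, by omega, rfl⟩, ?_⟩
    simpa [and_assoc] using hbal

/-- There is no code of length `19` and minimum distance `8`, given by its columns in a suitable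
basis, with five good columns, two of which are `1` and `16` with `17` not a column. -/
theorem false_of_five_good {L : Multiset ℕ} (hcard : L.card = 19) (hlt : ∀ x ∈ L, x < 64)
    (hw : ∀ u, 0 < u → u < 64 → 8 ≤ L.countP (fun x => dotBit u x = true))
    (hmem : ∀ x ∈ [1, 2, 3, 4, 5, 8, 9, 16, 32, 48], x ∈ L)
    (T : Finset ℕ) (hT : T.card = 5) (h16 : 16 ∈ T)
    (hgood : ∀ x ∈ T, x ∈ L ∧ 6 ≤ L.countP (fun y => x ^^^ y ∈ L)) : False := by
  have hsplit : L = L.filter (fun x => x / 16 = 0) + L.filter (fun x => x / 16 = 1) +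
      L.filter (fun x => x / 16 = 2) + L.filter (fun x => x / 16 = 3) := by
    ext a
    simp only [Multiset.count_add, Multiset.count_filter]
    by_cases ha : a ∈ L
    · have := hlt a ha
      split_ifs <;> omega
    · simp [Multiset.count_eq_zero_of_notMem ha]
  obtain ⟨S, hS⟩ : ∃ S, S = L.filter (fun x => x / 16 = 0) := ⟨_, rfl⟩
  obtain ⟨Q, hQ⟩ : ∃ Q : ℕ → Multiset ℕ, ∀ c, Q c = L.filter (fun x => x / 16 = c) :=
    ⟨_, fun _ => rfl⟩
  rw [← hS, ← hQ, ← hQ, ← hQ] at hsplit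
  have hQmem : ∀ c, ∀ x ∈ Q c, x ∈ L ∧ x / 16 = c := fun c x hx => by
    rwa [hQ, Multiset.mem_filter] at hx
  have hSeq : (starPoints : Multiset ℕ) = S := by
    rw [hS]
    refine filter_div_eq_starPoints hcard hlt hw fun x hx => hmem x ?_
    have : ∀ x ∈ starPoints, x ∈ [1, 2, 3, 4, 5, 8, 9, 16, 32, 48] := by decide
    exact this x hx
  -- The star span and one coset form a hyperplane, which holds at most 19 - 8 = 11 columns. So each
  -- coset has at most 4, and the total forces equality.
  have hcount : ∀ u c, (∀ x < 64, x / 16 = 0 → dotBit u x = false) →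
      (∀ x < 64, x / 16 = c → dotBit u x = false) → 0 < u → u < 64 → 0 < c →
      S.card + (Q c).card ≤ 11 := by
    intro u c h0 h1 hu hu64 hc
    have hle : S + Q c ≤ L.filter (fun x => ¬ dotBit u x = true) := by
      rw [Multiset.le_filter]
      refine ⟨?_, ?_⟩
      · rw [Multiset.le_iff_count]
        intro a
        rw [hS, hQ, Multiset.count_add, Multiset.count_filter, Multiset.count_filter]
        split_ifs <;> omega
      · intro x hx
        rw [Multiset.mem_add] at hx
        rcases hx with hx | hx
        · rw [hS, Multiset.mem_filter] at hx
          simp [h0 x (hlt x hx.1) hx.2]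
        · simp [h1 x (hlt x (hQmem c x hx).1) (hQmem c x hx).2]
    have h2 := Multiset.card_le_card hle
    have h3 := Multiset.card_eq_countP_add_countP (fun x => dotBit u x = true) L
    rw [Multiset.card_add, ← Multiset.countP_eq_card_filter] at h2
    have := hw u hu hu64
    omega
  have hc1 := hcount 32 1 (by decide +kernel) (by decide +kernel) (by norm_num) (by norm_num)
    (by norm_num)
  have hc2 := hcount 16 2 (by decide +kernel) (by decide +kernel) (by norm_num) (by norm_num)
    (by norm_num)
  have hc3 := hcount 48 3 (by decide +kernel) (by decide +kernel) (by norm_num) (by norm_num)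
    (by norm_num)
  have hS7 : S.card = 7 := by rw [← hSeq]; rfl
  have htot : S.card + (Q 1).card + (Q 2).card + (Q 3).card = 19 := by
    rw [← hcard]
    conv_rhs => rw [hsplit]
    simp only [Multiset.card_add]
  have hQcard : ∀ c ∈ [1, 2, 3], (Q c).card = 4 := by
    simp only [List.mem_cons, List.not_mem_nil, or_false, forall_eq_or_imp, forall_eq]
    omega
  have hQle : ∀ c ∈ [1, 2, 3], (starPoints : Multiset ℕ) + Q c ≤ L := by
    intro c hc
    have hc0 : c ≠ 0 := by rintro rfl; simp at hc
    rw [Multiset.le_iff_count, hSeq]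
    intro a
    rw [hS, hQ, Multiset.count_add, Multiset.count_filter, Multiset.count_filter]
    split_ifs <;> omega
  -- `u` cuts out the star span together with coset `c`; there `2 ^ i` reads bit `i` and `t` its
  -- complement on the coset. Each of the two vanishes on five star points.
  have hfun : ∀ c ∈ [1, 2, 3], ∀ i ∈ [1, 2, 3], ∃ u, 0 < u ∧ u < 64 ∧ ∃ t, 0 < t ∧ t < 64 ∧
      u ≠ 2 ^ i ∧ u ≠ t ∧ (∀ x < 64, x / 16 = c → dotBit u x = false ∧
        dotBit (2 ^ i) x = x.testBit i ∧ dotBit t x = !x.testBit i) ∧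
      5 ≤ starPoints.countP (fun x => dotBit u x = false ∧ dotBit (2 ^ i) x = false) ∧
      5 ≤ starPoints.countP (fun x => dotBit u x = false ∧ dotBit t x = false) := by
    have h : ∀ c ∈ [1, 2, 3], ∀ i ∈ [1, 2, 3], ∃ u ∈ [16, 32, 48],
      ∃ e ∈ [16, 32], u ≠ 2 ^ i ∧ u ≠ 2 ^ i + e ∧ (∀ x < 64, x / 16 = c → dotBit u x = false ∧
        dotBit (2 ^ i) x = x.testBit i ∧ dotBit (2 ^ i + e) x = !x.testBit i) ∧
      5 ≤ starPoints.countP (fun x => dotBit u x = false ∧ dotBit (2 ^ i) x = false) ∧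
      5 ≤ starPoints.countP (fun x => dotBit u x = false ∧ dotBit (2 ^ i + e) x = false) := by
      decide +kernel
    intro c hc i hi
    obtain ⟨u, hu, e, he, h⟩ := h c hc i hi
    have hu' : 0 < u ∧ u < 64 := by
      have : ∀ u ∈ [16, 32, 48], 0 < u ∧ u < 64 := by decide
      exact this u hu
    have he' : 0 < 2 ^ i + e ∧ 2 ^ i + e < 64 := by
      have : ∀ i ∈ [1, 2, 3], ∀ e ∈ [16, 32], 0 < 2 ^ i + e ∧ 2 ^ i + e < 64 := by decide
      exact this i hi e he
    exact ⟨u, hu'.1, hu'.2, 2 ^ i + e, he'.1, he'.2, h⟩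
  -- Each of these subspaces has at most 7 columns, 5 of them in the star: at most two of the four
  -- coset points have bit `i` set, and at most two have it clear.
  have hbal : ∀ c ∈ [1, 2, 3], ∀ i ∈ [1, 2, 3],
      (Q c).countP (fun x => x.testBit i = true) = 2 := by
    intro c hc i hi
    obtain ⟨u, hu, hu64, t, ht, ht64, hui, hut, hx, h1, h2⟩ := hfun c hc i hi
    have hi64 : 0 < 2 ^ i ∧ 2 ^ i < 64 := by
      have : ∀ i ∈ [1, 2, 3], 0 < 2 ^ i ∧ 2 ^ i < 64 := by decide
      exact this i hi
    have e1 := countP_two_functionals hcard hw hu hu64 hi64.1 hi64.2 hui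
    have e2 := countP_two_functionals hcard hw hu hu64 ht ht64 hut
    have f1 := (Multiset.countP_le_of_le
      (fun x => dotBit u x = false ∧ dotBit (2 ^ i) x = false) (hQle c hc)).trans e1
    have f2 := (Multiset.countP_le_of_le
      (fun x => dotBit u x = false ∧ dotBit t x = false) (hQle c hc)).trans e2
    rw [Multiset.countP_add, Multiset.coe_countP] at f1 f2
    have g1 : (Q c).countP (fun x => dotBit u x = false ∧ dotBit (2 ^ i) x = false) =
        (Q c).countP (fun x => ¬ x.testBit i = true) := by
      refine Multiset.countP_congr rfl fun x hxm => ?_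
      obtain ⟨a1, a2, a3⟩ := hx x (hlt x (hQmem c x hxm).1) (hQmem c x hxm).2
      simp [a1, a2]
    have g2 : (Q c).countP (fun x => dotBit u x = false ∧ dotBit t x = false) =
        (Q c).countP (fun x => x.testBit i = true) := by
      refine Multiset.countP_congr rfl fun x hxm => ?_
      obtain ⟨a1, a2, a3⟩ := hx x (hlt x (hQmem c x hxm).1) (hQmem c x hxm).2
      simp [a1, a3]
    have h3 := Multiset.card_eq_countP_add_countP (fun x => x.testBit i = true) (Q c)
    rw [hQcard c hc] at h3
    omega
  have hquad : ∀ c ∈ [1, 2, 3], ∃ l ∈ quadruples c, (l : Multiset ℕ) = Q c := by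
    intro c hc
    refine mem_quadruples (hQcard c hc) (fun x hx => (hQmem c x hx).2) ?_ (hbal c hc)
    rw [hQ, Multiset.mem_filter]
    refine ⟨hmem _ ?_, by omega⟩
    revert c; decide
  obtain ⟨a, ha, hQa⟩ := hquad 1 (by simp)
  obtain ⟨b, hb, hQb⟩ := hquad 2 (by simp)
  obtain ⟨c, hc, hQc⟩ := hquad 3 (by simp)
  obtain ⟨l, hl⟩ : ∃ l, l = starPoints ++ a ++ b ++ c := ⟨_, rfl⟩
  have hL : L = (l : Multiset ℕ) := by
    rw [hsplit, ← hSeq, ← hQa, ← hQb, ← hQc, hl]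
    simp only [Multiset.coe_add]
  have hfew : fewGood l = true := by
    rw [hl]
    apply fewGood_of_quadruples ha hb hc
    · intro u hu
      rw [functionals, List.mem_range'_1] at hu
      have := hw u (by omega) (by omega)
      rw [hL, Multiset.coe_countP, hl] at this
      simpa using this
    · rw [← hl, ← Multiset.coe_card, ← hL, hcard]
  rw [hL] at hgood
  have hgood' : ∀ x ∈ T, x ∈ l ∧ isGood (mask l) l x = true := by
    intro x hx
    obtain ⟨h1, h2⟩ := hgood x hx
    refine ⟨h1, ?_⟩
    rw [isGood, Nat.ble_eq]
    rw [Multiset.coe_countP] at h2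
    refine h2.trans_eq (List.countP_congr fun y _ => ?_)
    rw [testBit_mask]
    simp
  simp only [fewGood, force_eq, (hgood' 16 h16).2, Bool.not_true, Bool.false_or, Nat.ble_eq] at hfew
  have hsub : T ⊆ (l.filter (isGood (mask l) l)).toFinset := by
    intro x hx
    simpa using hgood' x hx
  have h1 := Finset.card_le_card hsub
  have h2 := List.toFinset_card_le (l.filter (isGood (mask l) l))
  rw [← List.countP_eq_length_filter] at h2
  omega

end PIR

/-! ### Coordinates: vectors as numbers below 64 -/

namespace PIR

open Finset Module

/-- The number with the binary digits `a, b, c, d, e, f`. -/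
def ofBits (a b c d e f : ZMod 2) : ℕ :=
  a.val * 32 + b.val * 16 + c.val * 8 + d.val * 4 + e.val * 2 + f.val

theorem ofBits_lt : ∀ a b c d e f : ZMod 2, ofBits a b c d e f < 64 := by
  decide +kernel

theorem ofBits_add : ∀ a b c d e f a' b' c' d' e' f' : ZMod 2,
    ofBits (a + a') (b + b') (c + c') (d + d') (e + e') (f + f') =
      ofBits a b c d e f ^^^ ofBits a' b' c' d' e' f' := by
  decide +kernel

theorem ofBits_eq_zero : ∀ a b c d e f : ZMod 2, ofBits a b c d e f = 0 →
    a = 0 ∧ b = 0 ∧ c = 0 ∧ d = 0 ∧ e = 0 ∧ f = 0 := by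
  decide +kernel

theorem exists_dual_ofBits : ∀ u < 64, ∃ a' b' c' d' e' f' : ZMod 2,
    ∀ a b c d e f : ZMod 2, a' * a + b' * b + c' * c + d' * d + e' * e + f' * f ≠ 0 ↔
      dotBit u (ofBits a b c d e f) = true := by
  intro u hu
  have h : ∀ u < 64, ∀ a b c d e f : ZMod 2,
      (if u.testBit 5 then 1 else 0) * a + (if u.testBit 4 then 1 else 0) * b +
      (if u.testBit 3 then 1 else 0) * c + (if u.testBit 2 then 1 else 0) * d +
      (if u.testBit 1 then 1 else 0) * e + (if u.testBit 0 then 1 else 0) * f ≠ 0 ↔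
      dotBit u (ofBits a b c d e f) = true := by
    decide +kernel
  exact ⟨_, _, _, _, _, _, h u hu⟩

theorem exists_dotBit_ofBits : ∀ u < 64, 0 < u →
    ∃ a b c d e f : ZMod 2, dotBit u (ofBits a b c d e f) = true := by
  decide +kernel

variable {n : ℕ} {V : Type*} [AddCommGroup V] [Module (ZMod 2) V]

/-- `ψ` identifies `V` with the numbers below `64` such that addition becomes `xor` and every
nonzero functional corresponds to some `dotBit u`. -/
structure IsCoordinates (ψ : V → ℕ) : Prop where
  lt : ∀ x, ψ x < 64
  add : ∀ x y, ψ (x + y) = ψ x ^^^ ψ y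
  injective : Function.Injective ψ
  dual : ∀ u, 0 < u → u < 64 → ∃ f : Dual (ZMod 2) V, f ≠ 0 ∧
    ∀ x, f x ≠ 0 ↔ dotBit u (ψ x) = true

theorem exists_isCoordinates (hV : finrank (ZMod 2) V = 6) {b : Fin 6 → V}
    (hb : LinearIndependent (ZMod 2) b) :
    ∃ ψ : V → ℕ, IsCoordinates ψ ∧ ∀ i, ψ (b i) = ![32, 16, 8, 4, 2, 1] i := by
  let B := basisOfLinearIndependentOfCardEqFinrank hb (by simp [hV])
  let φ := B.equivFun
  refine ⟨fun x => ofBits (φ x 0) (φ x 1) (φ x 2) (φ x 3) (φ x 4) (φ x 5), ⟨?_, ?_, ?_, ?_⟩, ?_⟩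
  · exact fun x => ofBits_lt _ _ _ _ _ _
  · intro x y
    simp only [map_add, Pi.add_apply]
    exact ofBits_add _ _ _ _ _ _ _ _ _ _ _ _
  · intro x y hxy
    -- In characteristic 2, equality of `x` and `y` is the vanishing of `x + y`.
    have h : ofBits (φ (x + y) 0) (φ (x + y) 1) (φ (x + y) 2) (φ (x + y) 3) (φ (x + y) 4)
        (φ (x + y) 5) = 0 := by
      simp only [map_add, Pi.add_apply]
      rw [ofBits_add]
      exact Nat.xor_eq_zero_iff.2 hxy
    obtain ⟨h0, h1, h2, h3, h4, h5⟩ := ofBits_eq_zero _ _ _ _ _ _ h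
    have hφ : φ (x + y) = 0 := by
      funext i
      fin_cases i <;> assumption
    have := eq_add_of_add_eq' (φ.map_eq_zero_iff.1 hφ)
    rw [this, add_zero]
  · intro u hu hu64
    obtain ⟨a', b', c', d', e', f', h⟩ := exists_dual_ofBits u hu64
    obtain ⟨a, b, c, d, e, f, h'⟩ := exists_dotBit_ofBits u hu64 hu
    let F : Dual (ZMod 2) V := (a' • LinearMap.proj 0 + b' • LinearMap.proj 1 +
      c' • LinearMap.proj 2 + d' • LinearMap.proj 3 + e' • LinearMap.proj 4 +
      f' • LinearMap.proj 5 : (Fin 6 → ZMod 2) →ₗ[ZMod 2] ZMod 2) ∘ₗ φ.toLinearMap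
    have hF : ∀ x, F x ≠ 0 ↔ dotBit u (ofBits (φ x 0) (φ x 1) (φ x 2) (φ x 3) (φ x 4) (φ x 5)) =
        true := fun x => h _ _ _ _ _ _
    refine ⟨F, fun h0 => ?_, hF⟩
    have := (hF (φ.symm ![a, b, c, d, e, f])).2 (by simpa using h')
    rw [h0] at this
    exact this rfl
  · intro i
    have hi : φ (b i) = Pi.single i 1 := by
      have : b i = B i := by simp [B]
      funext j
      rw [this, B.equivFun_self, Pi.single_apply]
      simp only [eq_comm]
    simp only [hi]
    fin_cases i <;> decide

end PIR

/-! ### Stars and multiple columns -/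

namespace PIR

open Finset Module

variable {n : ℕ} {V : Type*} [AddCommGroup V]

/-- `v` is a column and there are three disjoint pairs of other columns with sum `v`. -/
def IsStar (c : Fin n → V) (v : V) : Prop :=
  ∃ (h₀ : Fin n) (R : Fin 3 → Finset (Fin n)), c h₀ = v ∧ (∀ k, h₀ ∉ R k) ∧
    (∀ k, #(R k) = 2) ∧ (∀ k, ∑ h ∈ R k, c h = v) ∧ ∀ k l, k ≠ l → Disjoint (R k) (R l)

/-- `v` is a column twice, and either a third time or the sum of two other columns. -/
def IsMultiple (c : Fin n → V) (v : V) : Prop :=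
  ∃ h₁ h₂, h₁ ≠ h₂ ∧ c h₁ = v ∧ c h₂ = v ∧ ((∃ h₃, h₃ ≠ h₁ ∧ h₃ ≠ h₂ ∧ c h₃ = v) ∨
    ∃ p p', p ≠ p' ∧ p ∉ ({h₁, h₂} : Finset (Fin n)) ∧ p' ∉ ({h₁, h₂} : Finset (Fin n)) ∧
      c p + c p' = v)

theorem isStar_of_small_sets {c : Fin n → V} {v : V} {R : Fin 8 → Finset (Fin n)}
    (hR : ∀ j, ∑ h ∈ R j, c h = v) (hdisj : ∀ j j', j ≠ j' → Disjoint (R j) (R j'))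
    {h₀ : Fin n} (h₀v : c h₀ = v) {J : Finset (Fin 8)} (hJ3 : 3 ≤ #J)
    (hJ : ∀ j ∈ J, #(R j) = 2) (hJ₀ : ∀ j ∈ J, h₀ ∉ R j) : IsStar c v := by
  obtain ⟨K, hK, hK3⟩ := exists_subset_card_eq hJ3
  let e := K.orderEmbOfFin hK3
  have he : ∀ k, e k ∈ J := fun k => hK (K.orderEmbOfFin_mem hK3 k)
  exact ⟨h₀, fun k => R (e k), h₀v, fun k => hJ₀ _ (he k), fun k => hJ _ (he k), fun k => hR _,
    fun k k' hk => hdisj _ _ fun h => hk (e.injective h)⟩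

/-- For n = 19 the count reads 5 ≤ 2a + b, with `a` singletons and `b` pairs. If a = 0 there are
five pairs, at most one of them containing `h₀`; if a = 1 there are three; if a = 2 there is one. -/
theorem isStar_or_isMultiple {c : Fin 19 → V} {v : V} (hv : v ≠ 0) {h₀ : Fin 19} (h₀v : c h₀ = v)
    {R : Fin 8 → Finset (Fin 19)} (hR : ∀ j, ∑ h ∈ R j, c h = v)
    (hdisj : ∀ j j', j ≠ j' → Disjoint (R j) (R j')) : IsStar c v ∨ IsMultiple c v := by
  have hcount := count_small_sets hv hR hdisj
  have hone : ∀ j, #(R j) = 1 → ∃ h, R j = {h} ∧ c h = v := by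
    intro j hj
    obtain ⟨h, hh⟩ := card_eq_one.1 hj
    have hs := hR j
    rw [hh, sum_singleton] at hs
    exact ⟨h, hh, hs⟩
  rcases Nat.lt_or_ge 1 #{j | #(R j) = 1} with ha | ha
  · right
    obtain ⟨j₁, hj₁, j₂, hj₂, hne⟩ := one_lt_card.1 ha
    obtain ⟨h₁, hR₁, hv₁⟩ := hone j₁ (mem_filter.1 hj₁).2
    obtain ⟨h₂, hR₂, hv₂⟩ := hone j₂ (mem_filter.1 hj₂).2
    have hne' : h₁ ≠ h₂ := by
      have := hdisj _ _ hne
      rw [hR₁, hR₂, disjoint_singleton] at this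
      exact this
    refine ⟨h₁, h₂, hne', hv₁, hv₂, ?_⟩
    rcases Nat.lt_or_ge 2 #{j | #(R j) = 1} with ha3 | ha3
    · left
      obtain ⟨j₃, hj₃, hj₃'⟩ := exists_mem_notMem_of_card_lt_card
        (s := {j₁, j₂}) (t := ({j | #(R j) = 1} : Finset (Fin 8))) (card_le_two.trans_lt ha3)
      obtain ⟨h₃, hR₃, hv₃⟩ := hone j₃ (mem_filter.1 hj₃).2
      simp only [mem_insert, mem_singleton, not_or] at hj₃'
      have h1 := hdisj _ _ hj₃'.1
      have h2 := hdisj _ _ hj₃'.2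
      rw [hR₃, hR₁, disjoint_singleton] at h1
      rw [hR₃, hR₂, disjoint_singleton] at h2
      exact ⟨h₃, h1, h2, hv₃⟩
    · right
      obtain ⟨j, hj⟩ : ({j | #(R j) = 2} : Finset (Fin 8)).Nonempty := by
        rw [← card_pos]; omega
      have hj2 := (mem_filter.1 hj).2
      obtain ⟨p, p', hpp, hp⟩ := card_eq_two.1 hj2
      have hs := hR j
      rw [hp, sum_pair hpp] at hs
      have hnot : ∀ q ∈ R j, q ∉ ({h₁, h₂} : Finset (Fin 19)) := by
        intro q hq
        have e1 : j ≠ j₁ := by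
          rintro rfl; have := (mem_filter.1 hj₁).2; omega
        have e2 : j ≠ j₂ := by
          rintro rfl; have := (mem_filter.1 hj₂).2; omega
        have d1 := Finset.disjoint_left.1 (hdisj _ _ e1) hq
        have d2 := Finset.disjoint_left.1 (hdisj _ _ e2) hq
        rw [hR₁] at d1
        rw [hR₂] at d2
        simp only [mem_singleton] at d1 d2
        simp [d1, d2]
      exact ⟨p, p', hpp, hnot p (by simp [hp]), hnot p' (by simp [hp]), hs⟩
  · left
    by_cases ha0 : #{j | #(R j) = 1} = 0
    · refine isStar_of_small_sets hR hdisj h₀v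
        (J := ({j | #(R j) = 2} : Finset (Fin 8)).filter fun j => h₀ ∉ R j) ?_
        (fun j hj => (mem_filter.1 (mem_filter.1 hj).1).2) (fun j hj => (mem_filter.1 hj).2)
      have h1 := card_filter_add_card_filter_not (s := ({j | #(R j) = 2} : Finset (Fin 8)))
        (fun j => h₀ ∈ R j)
      have h2 : #{j ∈ ({j | #(R j) = 2} : Finset (Fin 8)) | h₀ ∈ R j} ≤ 1 := by
        rw [card_le_one]
        intro a ha b hb
        by_contra hab
        exact Finset.disjoint_left.1 (hdisj a b hab) (mem_filter.1 ha).2 (mem_filter.1 hb).2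
      omega
    · obtain ⟨j₁, hj₁⟩ : ({j | #(R j) = 1} : Finset (Fin 8)).Nonempty := by
        rw [← card_pos]; omega
      have hj1 := (mem_filter.1 hj₁).2
      obtain ⟨h₁, hR₁, hv₁⟩ := hone j₁ hj1
      refine isStar_of_small_sets hR hdisj hv₁ (J := {j | #(R j) = 2}) (by omega)
        (fun j hj => (mem_filter.1 hj).2) fun j hj hh => ?_
      have hj2 := (mem_filter.1 hj).2
      have e1 : j ≠ j₁ := by
        rintro rfl; omega
      exact Finset.disjoint_left.1 (hdisj _ _ e1) hh (by simp [hR₁])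

variable [Module (ZMod 2) V]

/-- At most one vector is a multiple column. -/
theorem IsMultiple.eq [Finite V] (hV : finrank (ZMod 2) V = 6) {c : Fin 19 → V}
    (hc : HasDistance 8 c) {v v' : V} (hv : v ≠ 0) (h : IsMultiple c v)
    (h' : IsMultiple c v') : v = v' := by
  classical
  by_contra hne
  obtain ⟨h₁, h₂, h12, hc₁, hc₂, h⟩ := h
  obtain ⟨k₁, k₂, k12, hk₁, hk₂, -⟩ := h'
  have hhk : ∀ a b, c a = v → c b = v' → a ≠ b := by
    rintro a b ha hb rfl
    exact hne (ha.symm.trans hb)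
  have h4 : #({h₁, h₂, k₁, k₂} : Finset (Fin 19)) = 4 := by
    rw [card_eq_succ]
    refine ⟨h₁, {h₂, k₁, k₂}, ?_, rfl, card_eq_three.2 ⟨h₂, k₁, k₂, hhk _ _ hc₂ hk₁,
      hhk _ _ hc₂ hk₂, k12, rfl⟩⟩
    simp [h12, hhk _ _ hc₁ hk₁, hhk _ _ hc₁ hk₂]
  have hspan : ∀ B : Finset V, v ∈ B → v' ∈ B → ∀ q ∈ ({h₁, h₂, k₁, k₂} : Finset (Fin 19)),
      c q ∈ Submodule.span (ZMod 2) (B : Set V) := by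
    intro B hB hB' q hq
    simp only [mem_insert, mem_singleton] at hq
    rcases hq with rfl | rfl | rfl | rfl
    · rw [hc₁]; exact Submodule.subset_span hB
    · rw [hc₂]; exact Submodule.subset_span hB
    · rw [hk₁]; exact Submodule.subset_span hB'
    · rw [hk₂]; exact Submodule.subset_span hB'
  -- The plane of `v` and `v'` holds at most four columns, and the two repetitions of each already
  -- fill it.
  have hfive : ∀ q, q ∉ ({h₁, h₂, k₁, k₂} : Finset (Fin 19)) →
      c q ∉ Submodule.span (ZMod 2) (({v, v'} : Finset V) : Set V) := by
    intro q hq hqs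
    have := hc.span_bound hV {v, v'} 2 (by norm_num) card_le_two
      (T := insert q {h₁, h₂, k₁, k₂}) (by
        intro h hh
        rcases mem_insert.1 hh with rfl | hh
        · exact hqs
        · exact hspan _ (by simp) (by simp) h hh)
    rw [card_insert_of_notMem hq, h4] at this
    omega
  have hvs : v ∈ Submodule.span (ZMod 2) (({v, v'} : Finset V) : Set V) :=
    Submodule.subset_span (by simp)
  have hvs' : v' ∈ Submodule.span (ZMod 2) (({v, v'} : Finset V) : Set V) :=
    Submodule.subset_span (by simp)
  rcases h with ⟨h₃, h31, h32, hc₃⟩ | ⟨p, p', hpp, hp, hp', hs⟩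
  · refine hfive h₃ ?_ (by rw [hc₃]; exact hvs)
    simp [h31, h32, hhk _ _ hc₃ hk₁, hhk _ _ hc₃ hk₂]
  -- If one member of the pair were `v'`, the other would be `v' + v`, a fifth column in the plane.
  -- Otherwise the pair raises the count to six in dimension 3, where five is the maximum.
  · have hout : ∀ p p', p' ∉ ({h₁, h₂} : Finset (Fin 19)) → c p + c p' = v → c p ≠ v' := by
      intro p p' hp' hs hpv
      have hs' : c p' = v' + v := by rw [← hpv]; exact eq_add_of_add_eq' hs
      refine hfive p' ?_ (by rw [hs']; exact add_mem hvs' hvs)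
      have hnk : ∀ k, c k = v' → p' ≠ k := by
        rintro k hk rfl
        rw [hs', add_eq_left] at hk
        exact hv hk
      simp only [mem_insert, mem_singleton, not_or] at hp' ⊢
      exact ⟨hp'.1, hp'.2, hnk _ hk₁, hnk _ hk₂⟩
    have hpv := hout p p' hp' hs
    have hpv' := hout p' p hp (by rw [add_comm]; exact hs)
    have hmem : ∀ q, q ∉ ({h₁, h₂} : Finset (Fin 19)) → c q ≠ v' →
        q ∉ ({h₁, h₂, k₁, k₂} : Finset (Fin 19)) := by
      intro q hq hqv
      have hnk : ∀ k, c k = v' → q ≠ k := by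
        rintro k hk rfl
        exact hqv hk
      simp only [mem_insert, mem_singleton, not_or] at hq ⊢
      exact ⟨hq.1, hq.2, hnk _ hk₁, hnk _ hk₂⟩
    have hcp' := eq_add_of_add_eq' hs
    have := hc.span_bound hV {v, v', c p} 3 (by norm_num) card_le_three
      (T := insert p (insert p' {h₁, h₂, k₁, k₂})) (by
        intro h hh
        have hvB : v ∈ Submodule.span (ZMod 2) (({v, v', c p} : Finset V) : Set V) :=
          Submodule.subset_span (by simp)
        have hpB : c p ∈ Submodule.span (ZMod 2) (({v, v', c p} : Finset V) : Set V) :=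
          Submodule.subset_span (by simp)
        rcases mem_insert.1 hh with rfl | hh
        · exact hpB
        rcases mem_insert.1 hh with rfl | hh
        · rw [hcp']; exact add_mem hpB hvB
        · exact hspan _ (by simp) (by simp) h hh)
    rw [card_insert_of_notMem, card_insert_of_notMem (hmem p' hp' hpv'), h4] at this
    · omega
    · rw [mem_insert, not_or]
      exact ⟨hpp, hmem p hp hpv⟩

/-- Each of the six columns in the three pairs has its partner as witness; this is the goodness
condition of the search. -/
theorem IsStar.six_le_card [DecidableEq V] {c : Fin n → V} {v : V} (h : IsStar c v) :
    6 ≤ #{h | ∃ h', c h' = v + c h} := by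
  obtain ⟨h₀, R, -, -, hR2, hR, hdisj⟩ := h
  have h1 : #(univ.biUnion R) = 6 := by
    rw [card_biUnion fun i _ i' _ h => hdisj i i' h, sum_congr rfl fun k _ => hR2 k]
    simp
  rw [← h1]
  refine card_le_card fun h hh => ?_
  obtain ⟨k, -, hk⟩ := mem_biUnion.1 hh
  obtain ⟨p, p', hpp, hp⟩ := card_eq_two.1 (hR2 k)
  have hs := hR k
  rw [hp, sum_pair hpp] at hs
  rw [hp, mem_insert, mem_singleton] at hk
  rw [mem_filter]
  refine ⟨mem_univ _, ?_⟩
  rcases hk with rfl | rfl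
  · exact ⟨p', by rw [add_comm]; exact eq_add_of_add_eq' hs⟩
  · exact ⟨p, by rw [add_comm]; exact eq_add_of_add_eq' (by rw [add_comm]; exact hs)⟩

/-- The seven columns of a star are exactly the columns in a four-dimensional subspace. -/
theorem IsStar.exists_independent [Finite V] (hV : finrank (ZMod 2) V = 6) {c : Fin 19 → V}
    (hc : HasDistance 8 c) {v : V} (h : IsStar c v) :
    ∃ x : Fin 3 → V, (∀ k, ∃ h, c h = x k) ∧ (∀ k, ∃ h, c h = x k + v) ∧
      LinearIndependent (ZMod 2) ![x 2, x 1, x 0, v] ∧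
      ∀ h, c h ∈ Submodule.span (ZMod 2) (Set.range ![x 2, x 1, x 0, v]) →
        c h = v ∨ ∃ k, c h = x k ∨ c h = x k + v := by
  classical
  obtain ⟨h₀, R, h₀v, h₀R, hR2, hR, hdisj⟩ := h
  have hex : ∀ k, ∃ p p', p ≠ p' ∧ R k = {p, p'} := fun k => card_eq_two.1 (hR2 k)
  choose p p' hpp hp using hex
  have hs : ∀ k, c (p' k) = c (p k) + v := by
    intro k
    have := hR k
    rw [hp, sum_pair (hpp k)] at this
    exact eq_add_of_add_eq' this
  set T := insert h₀ (univ.biUnion R) with hT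
  have hTcard : #T = 7 := by
    rw [hT, card_insert_of_notMem (by simpa using h₀R),
      card_biUnion fun i _ i' _ h => hdisj i i' h, sum_congr rfl fun k _ => hR2 k]
    simp
  have hTval : ∀ h ∈ T, c h = v ∨ ∃ k, c h = c (p k) ∨ c h = c (p k) + v := by
    intro h hh
    rcases mem_insert.1 hh with rfl | hh
    · exact Or.inl h₀v
    · obtain ⟨k, -, hk⟩ := mem_biUnion.1 hh
      rw [hp, mem_insert, mem_singleton] at hk
      rcases hk with rfl | rfl
      · exact Or.inr ⟨k, Or.inl rfl⟩
      · exact Or.inr ⟨k, Or.inr (hs k)⟩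
  set b : Fin 4 → V := ![c (p 2), c (p 1), c (p 0), v] with hb
  have hvb : v ∈ Submodule.span (ZMod 2) (Set.range b) := Submodule.subset_span ⟨3, rfl⟩
  have hpb : ∀ k, c (p k) ∈ Submodule.span (ZMod 2) (Set.range b) := by
    intro k
    fin_cases k
    · exact Submodule.subset_span ⟨2, rfl⟩
    · exact Submodule.subset_span ⟨1, rfl⟩
    · exact Submodule.subset_span ⟨0, rfl⟩
  have hTspan : ∀ h ∈ T, c h ∈ Submodule.span (ZMod 2) (Set.range b) := by
    intro h hh
    rcases hTval h hh with h1 | ⟨k, h1 | h1⟩ <;> rw [h1]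
    · exact hvb
    · exact hpb k
    · exact add_mem (hpb k) hvb
  refine ⟨fun k => c (p k), fun k => ⟨p k, rfl⟩, fun k => ⟨p' k, hs k⟩, ?_, ?_⟩
  -- Seven columns do not fit into dimension 3, where the maximum is five.
  · rw [linearIndependent_iff_card_le_finrank_span, Fintype.card_fin]
    have h1 := hc.subspace_bound _ hTspan
    rw [hTcard, hV] at h1
    by_contra! hlt
    have h2 : 2 ^ 3 ≤ 2 ^ (6 - finrank (ZMod 2) (Submodule.span (ZMod 2) (Set.range b))) :=
      Nat.pow_le_pow_right (by norm_num) (by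
        have : (Set.range b).finrank (ZMod 2) < 4 := hlt
        rw [Set.finrank] at this
        omega)
    omega
  -- An eighth column would exceed the maximum of seven in dimension 4.
  · intro h hh
    by_contra hnot
    have hhT : h ∉ T := fun h1 => hnot (hTval h h1)
    have h1 := hc.span_bound hV (univ.image b) 4 (by norm_num)
      (card_image_le.trans (by simp)) (T := insert h T) (by
        rw [coe_image, coe_univ, Set.image_univ]
        intro q hq
        rcases mem_insert.1 hq with rfl | hq
        · exact hh
        · exact hTspan q hq)
    rw [card_insert_of_notMem hhT, hTcard] at h1
    omega

end PIR

/-! ### Five stars are impossible -/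

namespace PIR

open Finset Module

variable {V : Type*}

/-- The columns of a code in coordinates. -/
def columnMultiset {n : ℕ} (ψ : V → ℕ) (c : Fin n → V) : Multiset ℕ :=
  univ.val.map fun h => ψ (c h)

theorem mem_columnMultiset {n : ℕ} {ψ : V → ℕ} {c : Fin n → V} {x : ℕ} :
    x ∈ columnMultiset ψ c ↔ ∃ h, ψ (c h) = x := by
  simp [columnMultiset]

theorem countP_columnMultiset {n : ℕ} {ψ : V → ℕ} {c : Fin n → V} (p : ℕ → Prop)
    [DecidablePred p] : (columnMultiset ψ c).countP p = #{h | p (ψ (c h))} := by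
  rw [columnMultiset, Multiset.countP_map]
  rfl

variable [AddCommGroup V] [Module (ZMod 2) V]

theorem IsCoordinates.weight {n : ℕ} {ψ : V → ℕ} (hψ : IsCoordinates ψ) {c : Fin n → V}
    (hc : HasDistance 8 c) (u : ℕ) (hu : 0 < u) (hu64 : u < 64) :
    8 ≤ (columnMultiset ψ c).countP (fun x => dotBit u x = true) := by
  obtain ⟨f, hf, hfu⟩ := hψ.dual u hu hu64
  rw [countP_columnMultiset]
  simpa only [hfu] using hc f hf

/-- The numbers below 32 correspond to the kernel of the functional reading the top bit. -/
theorem IsCoordinates.lt_of_mem_span {ψ : V → ℕ} (hψ : IsCoordinates ψ) {s : Set V}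
    (hs : ∀ x ∈ s, ψ x < 32) {y : V} (hy : y ∈ Submodule.span (ZMod 2) s) : ψ y < 32 := by
  obtain ⟨f, -, hf⟩ := hψ.dual 32 (by norm_num) (by norm_num)
  have hbit : ∀ x < 64, dotBit 32 x = true ↔ ¬ x < 32 := by decide +kernel
  have hf' : ∀ x, f x = 0 ↔ ψ x < 32 := by
    intro x
    have h1 := hf x
    rw [hbit _ (hψ.lt x)] at h1
    exact not_iff_not.1 h1
  have hle : Submodule.span (ZMod 2) s ≤ LinearMap.ker f :=
    Submodule.span_le.2 fun x hx => by simpa using (hf' x).2 (hs x hx)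
  exact (hf' y).1 (by simpa using hle hy)

/-- Two stars `v`, `v'` such that `v + v'` is not a column cannot exist together with three more
stars. -/
theorem false_of_five_stars [Finite V] (hV : finrank (ZMod 2) V = 6) {c : Fin 19 → V}
    (hc : HasDistance 8 c) {v v' : V} (hv : IsStar c v) (hv' : IsStar c v') (hne : v ≠ v')
    (hadj : ∀ h, c h ≠ v + v') {T : Finset V} (hT5 : #T = 5) (hv'T : v' ∈ T)
    (hT : ∀ t ∈ T, IsStar c t) : False := by
  classical
  obtain ⟨x, hx, hxv, hxind, hxspan⟩ := hv.exists_independent hV hc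
  obtain ⟨y, hy, hyv, hyind, -⟩ := hv'.exists_independent hV hc
  obtain ⟨h₀, -, hv₀, -⟩ := hv
  obtain ⟨h₀', -, hv₀', -⟩ := hv'
  have hv'span : v' ∉ Submodule.span (ZMod 2) (Set.range ![x 2, x 1, x 0, v]) := by
    intro hmem
    rw [← hv₀'] at hmem
    rcases hxspan h₀' hmem with h1 | ⟨k, h1 | h1⟩ <;> rw [hv₀'] at h1
    · exact hne h1.symm
    · obtain ⟨h, hh⟩ := hxv k
      exact hadj h (by rw [hh, h1, add_comm])
    · obtain ⟨h, hh⟩ := hx k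
      refine hadj h ?_
      rw [hh, h1, add_left_comm, zmod_two_add_self, add_zero]
  have hind5 : LinearIndependent (ZMod 2) ![v', x 2, x 1, x 0, v] :=
    linearIndependent_finCons.2 ⟨hxind, hv'span⟩
  -- The sixth basis vector stays free: first arbitrary, to find a pair of `v'` outside the
  -- five-dimensional span, then a member of that pair.
  have hcoords : ∀ w, w ∉ Submodule.span (ZMod 2) (Set.range ![v', x 2, x 1, x 0, v]) →
      ∃ ψ : V → ℕ, IsCoordinates ψ ∧ ψ w = 32 ∧ ψ v' = 16 ∧ ψ (x 2) = 8 ∧ ψ (x 1) = 4 ∧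
        ψ (x 0) = 2 ∧ ψ v = 1 ∧ ∀ t ∈ starPoints, t ∈ columnMultiset ψ c := by
    intro w hw
    have hind6 : LinearIndependent (ZMod 2) ![w, v', x 2, x 1, x 0, v] :=
      linearIndependent_finCons.2 ⟨hind5, hw⟩
    obtain ⟨ψ, hψ, hval⟩ := exists_isCoordinates hV hind6
    have e0 : ψ w = 32 := hval 0
    have e1 : ψ v' = 16 := hval 1
    have e2 : ψ (x 2) = 8 := hval 2
    have e3 : ψ (x 1) = 4 := hval 3
    have e4 : ψ (x 0) = 2 := hval 4
    have e5 : ψ v = 1 := hval 5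
    refine ⟨ψ, hψ, e0, e1, e2, e3, e4, e5, ?_⟩
    have hm : ∀ z, (∃ h, c h = z) → ψ z ∈ columnMultiset ψ c := by
      rintro z ⟨h, rfl⟩
      exact mem_columnMultiset.2 ⟨h, rfl⟩
    have m0 := hm _ ⟨h₀, hv₀⟩
    have m1 := hm _ (hx 0)
    have m2 := hm _ (hx 1)
    have m3 := hm _ (hx 2)
    have m4 := hm _ (hxv 0)
    have m5 := hm _ (hxv 1)
    have m6 := hm _ (hxv 2)
    rw [hψ.add] at m4 m5 m6
    rw [e5] at m0 m4 m5 m6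
    rw [e4] at m1 m4
    rw [e3] at m2 m5
    rw [e2] at m3 m6
    simp only [starPoints, List.mem_cons, List.not_mem_nil, or_false]
    rintro t (rfl | rfl | rfl | rfl | rfl | rfl | rfl) <;> assumption
  have hcard : ∀ ψ : V → ℕ, (columnMultiset ψ c).card = 19 := fun ψ => by simp [columnMultiset]
  have hlt : ∀ ψ : V → ℕ, IsCoordinates ψ → ∀ t ∈ columnMultiset ψ c, t < 64 := by
    intro ψ hψ t ht
    obtain ⟨h, rfl⟩ := mem_columnMultiset.1 ht
    exact hψ.lt _
  have hcol : ∀ ψ : V → ℕ, IsCoordinates ψ → ∀ z, ψ z ∈ columnMultiset ψ c ↔ ∃ h, c h = z := by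
    intro ψ hψ z
    rw [mem_columnMultiset]
    exact exists_congr fun h => hψ.injective.eq_iff
  have houtside : ∃ k, y k ∉ Submodule.span (ZMod 2) (Set.range ![v', x 2, x 1, x 0, v]) := by
    obtain ⟨w, hw⟩ : ∃ w, w ∉ Submodule.span (ZMod 2) (Set.range ![v', x 2, x 1, x 0, v]) := by
      by_contra! hall
      have h1 := finrank_range_le_card (R := ZMod 2) ![v', x 2, x 1, x 0, v]
      rw [Set.finrank, Submodule.eq_top_iff'.2 hall, finrank_top, hV] at h1
      simp at h1
    obtain ⟨ψ, hψ, -, e1, e2, e3, e4, e5, hstar⟩ := hcoords w hw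
    have hlt32 : ∀ z ∈ Submodule.span (ZMod 2) (Set.range ![v', x 2, x 1, x 0, v]), ψ z < 32 := by
      intro z hz
      refine hψ.lt_of_mem_span ?_ hz
      rintro _ ⟨i, rfl⟩
      fin_cases i <;> simp [e1, e2, e3, e4, e5]
    have h16 : 16 ∈ columnMultiset ψ c := by
      rw [← e1, hcol ψ hψ]; exact ⟨h₀', hv₀'⟩
    have h17 : 17 ∉ columnMultiset ψ c := by
      have : ψ (v + v') = 17 := by rw [hψ.add, e1, e5]; rfl
      rw [← this, hcol ψ hψ]
      rintro ⟨h, hh⟩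
      exact hadj h hh
    have hyx : ∀ k, ψ (y k) ∈ columnMultiset ψ c ∧ 16 ^^^ ψ (y k) ∈ columnMultiset ψ c := by
      intro k
      refine ⟨(hcol ψ hψ _).2 (hy k), ?_⟩
      rw [← e1, ← hψ.add, add_comm, hcol ψ hψ]
      exact hyv k
    have hyne : y 0 ≠ y 1 := fun h => by
      have := hyind.injective (a₁ := 2) (a₂ := 1) h
      simp at this
    have hyne' : y 0 ≠ v' + y 1 := fun h => by
      rw [Fintype.linearIndependent_iff] at hyind
      -- The relation `y 1 + y 0 + v' = 0`.
      have := hyind ![0, 1, 1, 1] (by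
        simp only [Fin.sum_univ_four, Matrix.cons_val, zero_smul, one_smul, zero_add]
        rw [h, add_comm (y 1), add_assoc v', zmod_two_add_self, add_zero, zmod_two_add_self]) 1
      simp at this
    have := exists_ge_of_pairs (hcard ψ) (hlt ψ hψ) (hψ.weight hc) hstar h16 h17
      (hyx 0).1 (hyx 0).2 (hyx 1).1 (hyx 1).2 (hψ.injective.ne hyne)
      (by rw [← e1, ← hψ.add]; exact hψ.injective.ne hyne')
    rcases this with h | h
    · exact ⟨0, fun h' => absurd (hlt32 _ h') (by omega)⟩
    · exact ⟨1, fun h' => absurd (hlt32 _ h') (by omega)⟩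
  obtain ⟨k, hk⟩ := houtside
  obtain ⟨ψ, hψ, e0, e1, -, -, -, -, hstar⟩ := hcoords (y k) hk
  refine false_of_five_good (hcard ψ) (hlt ψ hψ) (hψ.weight hc) ?_ (T.image ψ)
    (by rw [card_image_of_injective _ hψ.injective, hT5]) (mem_image.2 ⟨v', hv'T, e1⟩) ?_
  · have m16 : 16 ∈ columnMultiset ψ c := by
      rw [← e1, hcol ψ hψ]; exact ⟨h₀', hv₀'⟩
    have m32 : 32 ∈ columnMultiset ψ c := by
      rw [← e0, hcol ψ hψ]; exact hy k
    have m48 : 48 ∈ columnMultiset ψ c := by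
      have : ψ (y k + v') = 48 := by rw [hψ.add, e1, e0]; rfl
      rw [← this, hcol ψ hψ]; exact hyv k
    intro t ht
    rw [show [1, 2, 3, 4, 5, 8, 9, 16, 32, 48] = starPoints ++ [16, 32, 48] from rfl,
      List.mem_append] at ht
    rcases ht with ht | ht
    · exact hstar t ht
    · simp only [List.mem_cons, List.not_mem_nil, or_false] at ht
      rcases ht with rfl | rfl | rfl <;> assumption
  · intro t ht
    obtain ⟨z, hz, rfl⟩ := mem_image.1 ht
    have hzs := hT z hz
    refine ⟨?_, ?_⟩
    · obtain ⟨h, -, hh, -⟩ := hzs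
      exact (hcol ψ hψ z).2 ⟨h, hh⟩
    · rw [countP_columnMultiset]
      refine hzs.six_le_card.trans_eq ?_
      congr 1
      ext h
      simp only [mem_filter, mem_univ, true_and]
      rw [← hψ.add, hcol ψ hψ]

/-- Among three independent vectors there are two whose sum is not a column. -/
theorem HasDistance.exists_add_not_column [Finite V] (hV : finrank (ZMod 2) V = 6)
    {c : Fin 19 → V} (hc : HasDistance 8 c) {w : Fin 3 → V} (hw : LinearIndependent (ZMod 2) w)
    (hcol : ∀ i, ∃ h, c h = w i) : ∃ i j, i ≠ j ∧ ∀ h, c h ≠ w i + w j := by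
  classical
  by_contra! hall
  let g := Fintype.linearCombination (ZMod 2) w
  have hg : Function.Injective g := hw.fintypeLinearCombination_injective
  have hg' : ∀ a, g a = a 0 • w 0 + a 1 • w 1 + a 2 • w 2 := fun a => by
    simp [g, Fintype.linearCombination_apply, Fin.sum_univ_three]
  -- If all pairwise sums were columns, these six vectors would be columns in dimension 3, which
  -- holds at most five.
  let D : Finset (Fin 3 → ZMod 2) :=
    {![1, 0, 0], ![0, 1, 0], ![0, 0, 1], ![1, 1, 0], ![1, 0, 1], ![0, 1, 1]}
  have hDcol : ∀ a ∈ D, ∃ h, c h = g a := by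
    simp only [D, mem_insert, mem_singleton, forall_eq_or_imp, forall_eq, hg', Matrix.cons_val,
      one_smul, zero_smul, add_zero, zero_add]
    exact ⟨hcol 0, hcol 1, hcol 2, hall 0 1 (by decide), hall 0 2 (by decide),
      hall 1 2 (by decide)⟩
  have h6 : 6 ≤ #{h | c h ∈ D.image g} := by
    calc 6 = #D := by decide
      _ = #(D.image g) := (card_image_of_injective _ hg).symm
      _ ≤ #(({h | c h ∈ D.image g} : Finset (Fin 19)).image c) := card_le_card fun z hz => by
        obtain ⟨a, ha, rfl⟩ := mem_image.1 hz
        obtain ⟨h, hh⟩ := hDcol a ha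
        exact mem_image.2 ⟨h, by rw [mem_filter, hh]; exact ⟨mem_univ _, hz⟩, hh⟩
      _ ≤ _ := card_image_le
  have := hc.span_bound hV (univ.image w) 3 (by norm_num) (card_image_le.trans (by simp))
    (T := {h | c h ∈ D.image g}) (by
      intro h hh
      obtain ⟨a, -, ha⟩ := mem_image.1 (mem_filter.1 hh).2
      rw [← ha, coe_image, coe_univ, Set.image_univ]
      simp only [g, Fintype.linearCombination_apply]
      exact sum_mem fun i _ => Submodule.smul_mem _ _ (Submodule.subset_span ⟨i, rfl⟩))
  omega

/-- A code of length `19` and minimum distance `8` has no six independent columns with eight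
disjoint recovery sets each. -/
theorem not_systematic_of_length_nineteen {G : Matrix (Fin 6) (Fin 19) (ZMod 2)}
    (hG : IsPIRMatrix 8 G) (hsys : IsSystematic G) : False := by
  classical
  have hV : finrank (ZMod 2) (Fin 6 → ZMod 2) = 6 := by simp
  have hc := hG.hasDistance
  obtain ⟨f, hf⟩ := hsys
  let e : Fin 6 → Fin 6 → ZMod 2 := fun i => Pi.single i 1
  have he : LinearIndependent (ZMod 2) e := Pi.linearIndependent_single_one (Fin 6) (ZMod 2)
  have hcol : ∀ i, G.col (f i) = e i := by
    intro i
    funext j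
    have := congrFun (congrFun hf j) i
    simpa [Matrix.one_apply, e, Pi.single_apply] using this
  have hsm : ∀ i, IsStar G.col (e i) ∨ IsMultiple G.col (e i) := by
    intro i
    obtain ⟨R, hR, hdisj⟩ := hG i
    exact isStar_or_isMultiple (he.ne_zero i) (hcol i) hR hdisj
  have hI : 5 ≤ #{i | IsStar G.col (e i)} := by
    have h1 : #{i | ¬ IsStar G.col (e i)} ≤ 1 := by
      rw [card_le_one]
      intro i hi j hj
      exact he.injective (((hsm i).resolve_left (mem_filter.1 hi).2).eq hV hc (he.ne_zero i)
        ((hsm j).resolve_left (mem_filter.1 hj).2))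
    have h2 := card_filter_add_card_filter_not (s := (univ : Finset (Fin 6)))
      (fun i => IsStar G.col (e i))
    rw [card_univ, Fintype.card_fin] at h2
    omega
  obtain ⟨I, hIsub, hI5⟩ := exists_subset_card_eq hI
  have hstar : ∀ i ∈ I, IsStar G.col (e i) := fun i hi => (mem_filter.1 (hIsub hi)).2
  let g := I.orderEmbOfFin hI5
  have hgI : ∀ k, g k ∈ I := fun k => I.orderEmbOfFin_mem hI5 k
  -- Any three of the five stars are independent, so two of them have a sum that is not a column.
  let m : Fin 3 → Fin 6 := fun k => g (Fin.castLE (by norm_num) k)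
  have hm : Function.Injective m := g.injective.comp (Fin.castLE_injective _)
  obtain ⟨i, j, hij, hadj⟩ := hc.exists_add_not_column hV (w := e ∘ m) (he.comp m hm)
    fun i => ⟨_, hcol (m i)⟩
  exact false_of_five_stars hV hc (hstar _ (hgI _)) (hstar _ (hgI _))
    (he.injective.ne (hm.ne hij)) hadj (T := I.image e)
    (by rw [card_image_of_injective _ he.injective, hI5]) (mem_image_of_mem e (hgI _))
    (fun t ht => by
      obtain ⟨i, hi, rfl⟩ := mem_image.1 ht
      exact hstar i hi)

end PIR

/-! ### The explicit matrix and the conclusion -/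

namespace PIR

open Finset

/-- Eight disjoint recovery sets for each unit vector. -/
def recoverySetsG19 : Fin 6 → Fin 8 → Finset (Fin 19) :=
  ![![{0, 1}, {2, 3}, {7, 8}, {12, 13}, {16, 17}, {4, 11, 14}, {5, 9, 18}, {6, 10, 15}],
    ![{1, 18}, {4, 5}, {6, 8}, {11, 13}, {14, 15}, {0, 3, 10}, {2, 12, 16}, {7, 9, 17}],
    ![{0, 16}, {1, 17}, {4, 6}, {5, 8}, {10, 13}, {2, 9, 14}, {3, 12, 18}, {7, 11, 15}],
    ![{1, 15}, {2, 7}, {3, 8}, {9, 13}, {14, 18}, {0, 5, 11}, {4, 10, 16}, {6, 12, 17}],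
    ![{3, 9}, {5, 10}, {6, 11}, {7, 12}, {8, 13}, {0, 14, 17}, {1, 2, 4}, {15, 16, 18}],
    ![{0, 12}, {1, 13}, {9, 15}, {10, 17}, {11, 18}, {2, 5, 6}, {3, 4, 7}, {8, 14, 16}]]

theorem isPIRMatrix_G19 : IsPIRMatrix 8 G19 := by
  have hsum : ∀ i j, ∀ i', ∑ h ∈ recoverySetsG19 i j, G19 i' h =
      (Pi.single i 1 : Fin 6 → ZMod 2) i' := by decide +kernel
  have hdisj : ∀ i j j', j ≠ j' → Disjoint (recoverySetsG19 i j) (recoverySetsG19 i j') := by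
    decide +kernel
  refine fun i => ⟨recoverySetsG19 i, fun j => ?_, hdisj i⟩
  funext i'
  rw [Finset.sum_apply]
  exact hsum i j i'

theorem isProjective_G19 : IsProjective G19 := by
  have hcol : ∀ h h' : Fin 19, h ≠ h' → ∀ a b : ZMod 2,
      (∀ i, a * G19 i h + b * G19 i h' = 0) → a = 0 ∧ b = 0 := by decide +kernel
  intro h h' hne
  rw [LinearIndependent.pair_iff]
  intro a b hab
  exact hcol h h' hne a b fun i => by simpa using congrFun hab i

theorem not_isSystematic_G19 : ¬ IsSystematic G19 := by
  rintro ⟨f, hf⟩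
  -- The first unit vector is not a column.
  have hne : ∀ h : Fin 19, ∃ i, G19 i h ≠ (1 : Matrix (Fin 6) (Fin 6) (ZMod 2)) i 0 := by
    decide +kernel
  obtain ⟨i, hi⟩ := hne (f 0)
  exact hi (congrFun (congrFun hf i) 0)

theorem exists_isGeneratorMatrix_G19 :
    ∃ C : Submodule (ZMod 2) (Fin 19 → ZMod 2), IsGeneratorMatrix G19 C :=
  ⟨_, isPIRMatrix_G19.linearIndependent_row (by norm_num), rfl⟩

theorem IsPIRMatrix.nineteen_le {n : ℕ} {G : Matrix (Fin 6) (Fin n) (ZMod 2)}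
    (hG : IsPIRMatrix 8 G) : 19 ≤ n := by
  obtain ⟨R, hR, hdisj⟩ := hG 0
  refine hG.hasDistance.le_length (by simp) (v := Pi.single 0 1) (fun h => ?_) hR hdisj
  simpa using congrFun h 0

theorem P_six_eight : P 6 8 = 19 := by
  have hmem : 19 ∈ {n : ℕ | ∃ C : Submodule (ZMod 2) (Fin n → ZMod 2), IsPIRCode 6 8 C} := by
    obtain ⟨C, hC⟩ := exists_isGeneratorMatrix_G19
    exact ⟨C, G19, hC, isPIRMatrix_G19⟩
  refine le_antisymm (Nat.sInf_le hmem) (le_csInf ⟨_, hmem⟩ ?_)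
  rintro n ⟨C, G, -, hG⟩
  exact hG.nineteen_le

theorem IsSystematicPIRCode.twenty_le {n : ℕ} {C : Submodule (ZMod 2) (Fin n → ZMod 2)}
    (hC : IsSystematicPIRCode 6 8 C) : 20 ≤ n := by
  obtain ⟨G, -, hG, hsys⟩ := hC
  rcases hG.nineteen_le.eq_or_lt with rfl | h
  · exact (not_systematic_of_length_nineteen hG hsys).elim
  · exact h

end PIR

theorem mainTheorem11 :
    PIR.P 6 8 = 19 ∧
    ((∃ C : Submodule (ZMod 2) (Fin 19 → ZMod 2), PIR.IsGeneratorMatrix PIR.G19 C) ∧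
      PIR.IsPIRMatrix 8 PIR.G19 ∧ PIR.IsProjective PIR.G19 ∧ ¬ PIR.IsSystematic PIR.G19) ∧
    (∀ (n : ℕ) (C : Submodule (ZMod 2) (Fin n → ZMod 2)),
      PIR.IsSystematicPIRCode 6 8 C → 20 ≤ n) ∧
    ¬ (∀ s k : ℕ, 1 ≤ s → 1 ≤ k →
      ∃ C : Submodule (ZMod 2) (Fin (PIR.P s k) → ZMod 2), PIR.IsSystematicPIRCode s k C) := by
  refine ⟨PIR.P_six_eight, ⟨PIR.exists_isGeneratorMatrix_G19, PIR.isPIRMatrix_G19,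
    PIR.isProjective_G19, PIR.not_isSystematic_G19⟩, fun n C hC => hC.twenty_le, fun h => ?_⟩
  obtain ⟨C, hC⟩ := h 6 8 (by norm_num) (by norm_num)
  have := hC.twenty_le
  rw [PIR.P_six_eight] at this
  omega
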